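/- **Proposition 3.2 (De Giorgi type lemma).** Setting. Let $N\ge 2$, $p>1$, $s\in(0,1)$ with $ps<N$, let $\Omega\subseteq\mathbb R^N$ be open and connected, and let $0<\Lambda_1\le\Lambda_2$. Kernels are measurable functions $K:\mathbb R^N\times\mathbb R^N\to\mathbb R$ such that, for a.e. $(x,y)$, $K(x,y)=K(y,x)$ and $\Lambda_1\le K(x,y)|x-y|^{N+ps}\le\Lambda_2$. For an open set $V$, $W^{s,p}(V)$ is the set of $u\in L^p(V)$ with $[u]_{s,p,V}=\Big[\iint_{V\times V}\frac{|u(x)-u(y)|^p}{|x-y|^{N+ps}}\,dx\,dy\Big]^{1/p}<\infty$. For a bounded domain $U$, $\widetilde W^{s,p}(U)$ is the set of $u\in L^p_{\rm loc}(\mathbb R^N)$ such that $u\in W^{s,p}(V)$ for some open $V\Supset U$ and $\int_{\mathbb R^N}\frac{|u(x)|^{p-1}}{(1+|x|)^{N+ps}}\,dx<\infty$. Further, $\widetilde W^{s,p}_{\rm loc}(\Omega)$ is the set of $u\in L^p_{\rm loc}(\mathbb R^N)$ with $u\in\widetilde W^{s,p}(U)$ for all bounded domains $U\subseteq\Omega$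 (domain: open connected set). A function $u\in\widetilde W^{s,p}_{\rm loc}(\Omega)$ is a (weak local) supersolution (resp. subsolution) of $\mathcal L_Ku=0$ in $\Omega$ if for all $\varphi\in C^1_c(\Omega)$ with $\varphi\ge0$ $$\iint_{\mathbb R^N\times\mathbb R^N}|u(x)-u(y)|^{p-2}(u(x)-u(y))(\varphi(x)-\varphi(y))K(x,y)\,dx\,dy\ \ge 0\quad(\text{resp. }\le 0),$$ and a solution if it is both. The nonlocal tail is $${\rm Tail}(v,x_0,R)=\Big[R^{ps}\int_{\mathbb R^N\setminus B_R(x_0)}\frac{|v(x)|^{p-1}}{|x-x_0|^{N+ps}}\,dx\Big]^{\frac1{p-1}}.$$ Infima are essential infima, $B_R(x_0)$ and $\overline B_R(x_0)$ are the open and the closed Euclidean ball, $v_-=\max\{-v,0\}$, and $|\cdot|$ of a set is its Lebesgue measure. Statement. For every $\gamma\in(0,1)$ there exists $\nu\in(0,1)$, depending only on $N,p,s,\Omega,\Lambda_1,\Lambda_2$ and $\gamma$, with the following property. Let $K$ be a kernel as above, $u\in\widetilde W^{s,p}_{\rm loc}(\Omega)$ a solution of $\mathcal L_Ku=0$ in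 $\Omega$, $\overline B_{\bar\rho}(x_0)\subset\Omega$, $\rho_0\in(0,\bar\rho)$, $k>0$ and $\mu\in\mathbb R$ be such that $$\mu\le\inf_{B_{\bar\rho}(x_0)}u,\qquad k>\gamma\,{\rm Tail}((u-\mu)_-,x_0,\rho_0).$$ If $$\big|B_{\rho_0}(x_0)\cap\{u\le\mu+k\}\big|\le\nu\,|B_{\rho_0}(x_0)|,$$ then $u(x)>\mu+\dfrac k2$ for a.e. $x\in B_{\rho_0/2}(x_0)$. -/

import Mathlib

open MeasureTheory
open scoped ENNReal

noncomputable section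

namespace Nonlocal

/-- The space `ℝ^N` with the Euclidean norm and Lebesgue measure. -/
abbrev Rn (N : ℕ) : Type := EuclideanSpace ℝ (Fin N)

/-- The kernel class: `K` is (Lebesgue) measurable, symmetric a.e., and comparable a.e. to
`|x - y|^{-(N+ps)}`, with constants `Λ₁`, `Λ₂`. -/
structure IsKernel {N : ℕ} (p s Λ₁ Λ₂ : ℝ) (K : Rn N → Rn N → ℝ) : Prop where
  aemeasurable : AEMeasurable (fun z : Rn N × Rn N => K z.1 z.2) volume
  symm : ∀ᵐ z : Rn N × Rn N, K z.1 z.2 = K z.2 z.1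
  bounds : ∀ᵐ z : Rn N × Rn N,
    Λ₁ ≤ K z.1 z.2 * ‖z.1 - z.2‖ ^ ((N : ℝ) + p * s) ∧
      K z.1 z.2 * ‖z.1 - z.2‖ ^ ((N : ℝ) + p * s) ≤ Λ₂

/-- The nonlocal tail
`Tail(u, x₀, R) = [R^{ps} ∫_{B_R(x₀)^c} |u(x)|^{p-1} / |x - x₀|^{N+ps} dx]^{1/(p-1)}`,
with values in `[0, ∞]`. -/
def tail {N : ℕ} (p s : ℝ) (u : Rn N → ℝ) (x₀ : Rn N) (R : ℝ) : ℝ≥0∞ :=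
  (ENNReal.ofReal (R ^ (p * s)) *
    ∫⁻ x in (Metric.ball x₀ R)ᶜ,
      ENNReal.ofReal (|u x| ^ (p - 1) / ‖x - x₀‖ ^ ((N : ℝ) + p * s))) ^ (1 / (p - 1))

/-- The Gagliardo seminorm `[u]_{s,p,U}`, with values in `[0, ∞]`. -/
def gagliardoSeminorm {N : ℕ} (p s : ℝ) (u : Rn N → ℝ) (U : Set (Rn N)) : ℝ≥0∞ :=
  (∫⁻ z in U ×ˢ U,
    ENNReal.ofReal (|u z.1 - u z.2| ^ p / ‖z.1 - z.2‖ ^ ((N : ℝ) + p * s))) ^ (1 / p)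

/-- `u ∈ W^{s,p}(U)`. -/
def MemFracSobolev {N : ℕ} (p s : ℝ) (u : Rn N → ℝ) (U : Set (Rn N)) : Prop :=
  MemLp u (ENNReal.ofReal p) (volume.restrict U) ∧ gagliardoSeminorm p s u U < ∞

/-- `u ∈ L^p_loc(ℝ^N)`. -/
def MemLpLoc {N : ℕ} (p : ℝ) (u : Rn N → ℝ) : Prop :=
  ∀ A : Set (Rn N), IsCompact A → MemLp u (ENNReal.ofReal p) (volume.restrict A)

/-- `u ∈ W̃^{s,p}(U)` for a bounded set `U`: `u` is in `L^p_loc(ℝ^N)`, it is in `W^{s,p}(V)` for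
some open `V` that compactly contains `U`, and
`∫_{ℝ^N} |u(x)|^{p-1} / (1 + |x|)^{N+ps} dx` is finite. -/
def MemTildeSobolev {N : ℕ} (p s : ℝ) (u : Rn N → ℝ) (U : Set (Rn N)) : Prop :=
  MemLpLoc p u ∧
    (∃ V : Set (Rn N), IsOpen V ∧ IsCompact (closure U) ∧ closure U ⊆ V ∧
      MemFracSobolev p s u V) ∧
    ∫⁻ x : Rn N, ENNReal.ofReal (|u x| ^ (p - 1) / (1 + ‖x‖) ^ ((N : ℝ) + p * s)) < ∞

/-- `u ∈ W̃^{s,p}_loc(Ω)`: `u` is in `L^p_loc(ℝ^N)` and in `W̃^{s,p}(U)` for every bounded domain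
(open connected set) `U ⊆ Ω`. -/
def MemTildeSobolevLoc {N : ℕ} (p s : ℝ) (u : Rn N → ℝ) (Ω : Set (Rn N)) : Prop :=
  MemLpLoc p u ∧
    ∀ U : Set (Rn N), IsOpen U → IsConnected U → Bornology.IsBounded U → U ⊆ Ω →
      MemTildeSobolev p s u U

/-- The weak form
`∬ |u(x) - u(y)|^{p-2} (u(x) - u(y)) (φ(x) - φ(y)) K(x,y) dx dy` over `ℝ^N × ℝ^N`.
For `u ∈ W̃^{s,p}_loc(Ω)`, `Ω` a domain, `φ ∈ C^1_c(Ω)` and `K` in the kernel class, the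
integrand is absolutely integrable. -/
def weakForm {N : ℕ} (p : ℝ) (K : Rn N → Rn N → ℝ) (u φ : Rn N → ℝ) : ℝ :=
  ∫ z : Rn N × Rn N,
    |u z.1 - u z.2| ^ (p - 2) * (u z.1 - u z.2) * (φ z.1 - φ z.2) * K z.1 z.2

/-- `φ ∈ C^1_c(Ω)` and `φ ≥ 0`. -/
structure IsTestFunction {N : ℕ} (Ω : Set (Rn N)) (φ : Rn N → ℝ) : Prop where
  contDiff : ContDiff ℝ 1 φ
  hasCompactSupport : HasCompactSupport φ
  tsupport_subset : tsupport φ ⊆ Ω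
  nonneg : ∀ x, 0 ≤ φ x

/-- Weak local supersolutions of `L_K u = 0` in `Ω`. -/
def IsSupersolution {N : ℕ} (p s : ℝ) (K : Rn N → Rn N → ℝ) (Ω : Set (Rn N))
    (u : Rn N → ℝ) : Prop :=
  MemTildeSobolevLoc p s u Ω ∧ ∀ φ : Rn N → ℝ, IsTestFunction Ω φ → 0 ≤ weakForm p K u φ

/-- Weak local subsolutions of `L_K u = 0` in `Ω`. -/
def IsSubsolution {N : ℕ} (p s : ℝ) (K : Rn N → Rn N → ℝ) (Ω : Set (Rn N))
    (u : Rn N → ℝ) : Prop :=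
  MemTildeSobolevLoc p s u Ω ∧ ∀ φ : Rn N → ℝ, IsTestFunction Ω φ → weakForm p K u φ ≤ 0

/-- Weak local solutions of `L_K u = 0` in `Ω`. -/
def IsSolution {N : ℕ} (p s : ℝ) (K : Rn N → Rn N → ℝ) (Ω : Set (Rn N))
    (u : Rn N → ℝ) : Prop :=
  IsSupersolution p s K Ω u ∧ IsSubsolution p s K Ω u

/-- The essential infimum of `u` in `U`, with values in `[-∞, ∞]`. -/
def essInfOn {N : ℕ} (u : Rn N → ℝ) (U : Set (Rn N)) : EReal :=
  essInf (fun x => (u x : EReal)) (volume.restrict U)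

end Nonlocal

end

open MeasureTheory
open scoped ENNReal

noncomputable section

namespace Nonlocal

open Metric Set Filter Topology

/-! ### Integrals of powers of the distance. -/

section RadialIntegrals

variable {N : ℕ}

/-! The proof is a De Giorgi iteration in which the strength of the nonlocal kernel replaces the
Sobolev inequality. Write `d = N + ps` and `v = u - μ`, which is nonnegative in `B_ρbar`, and test
the supersolution inequality with `(l - v)₊ η^p`, where `η` is a cutoff. Keep only the interaction
of a low sublevel set `A' = {v < l'} ∩ B_r'` with the complement of a higher one `A = {v < l} ∩
B_r`. Inside `B_r`, `v` jumps there by at least `l - l'`, so the weak form is negative.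
`energy_estimate` and `exists_energy_le` then bound `(l - l')^p ∬_{A' × Aᶜ} |x - y|^{-d}` by a
constant times `|A|`. The constant collects the energy of the cutoff and the tail of `v₋`; the
hypothesis on `k` says that the tail is at most a multiple of `k^{p-1}`.

On the other hand, if `|B_t| = 2|A|`, then for every `x` at least half of `B_t(x)` lies outside `A`,
so the inner integral over `Aᶜ` is at least `t^{-d} |A|`
(`le_setLIntegral_compl_one_div_norm_rpow`). The factor `|A|` cancels and leaves `|A'| ≤ C t^d`,
which is of order `|A|^{1 + ps/N}` (`exists_sublevelBall_decay`). This is superlinear in `|A|`.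
Iterating over levels decreasing from `k` to `3k/4` and radii decreasing from `ρ₀` to `ρ₀/2` forces
the measures to zero once the initial density is small (`exists_deGiorgi_smallness`).

The test function is only of finite Gagliardo energy, not `C¹`. It is made admissible by
mollification: the weak form of a mollified function is an average of the weak forms of its
translates, and these depend continuously on the translation at `0`
(`IsRoughTestFunction.integral_flux_nonneg`). -/

theorem lintegral_comp_add_smul {f : Rn N → ℝ≥0∞} (hf : Measurable f) (x : Rn N) {r : ℝ}
    (hr : 0 < r) :
    ∫⁻ y, f y = ENNReal.ofReal (r ^ N) * ∫⁻ z, f (x + r • z) := by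
  have h1 : ∫⁻ z, f (x + r • z) = ENNReal.ofReal (r ^ N)⁻¹ * ∫⁻ y, f y := by
    have := lintegral_map (μ := (volume : Measure (Rn N))) (f := fun y => f (x + y))
      (hf.comp (measurable_const_add x)) (measurable_const_smul r)
    rw [← this, Measure.map_addHaar_smul _ hr.ne', lintegral_smul_measure, finrank_euclideanSpace,
      Fintype.card_fin, abs_of_pos (by positivity), lintegral_add_left_eq_self]
    rfl
  rw [h1, ← mul_assoc, ← ENNReal.ofReal_mul (by positivity), mul_inv_cancel₀ (by positivity)]
  simp

/-- Substitution `y = x + r z`. Balls and complements of balls are the cases `T = Iio 1` and `T =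
Ici 1`, so their constants do not depend on `x` and `r`. -/
theorem setLIntegral_norm_rpow_scaling (T : Set ℝ) (hT : MeasurableSet T) (a : ℝ) (x : Rn N)
    {r : ℝ} (hr : 0 < r) :
    ∫⁻ y in {y | ‖x - y‖ / r ∈ T}, ENNReal.ofReal (‖x - y‖ ^ a) =
      ENNReal.ofReal (r ^ ((N : ℝ) + a)) *
        ∫⁻ z in {z : Rn N | ‖z‖ ∈ T}, ENNReal.ofReal (‖z‖ ^ a) := by
  have hm1 : MeasurableSet {y : Rn N | ‖x - y‖ / r ∈ T} := by
    have : Measurable fun y : Rn N => ‖x - y‖ / r := by fun_prop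
    exact this hT
  have hm2 : MeasurableSet {z : Rn N | ‖z‖ ∈ T} := measurable_norm hT
  rw [← lintegral_indicator hm1, ← lintegral_indicator hm2,
    lintegral_comp_add_smul (Measurable.indicator (by fun_prop) hm1) x hr,
    Real.rpow_add hr, Real.rpow_natCast, ENNReal.ofReal_mul (by positivity), mul_assoc,
    ← lintegral_const_mul _ (Measurable.indicator (by fun_prop) hm2)]
  congr 1
  refine lintegral_congr fun z => ?_
  have h : ‖x - (x + r • z)‖ = r * ‖z‖ := by
    rw [sub_add_cancel_left, norm_neg, norm_smul, Real.norm_of_nonneg hr.le]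
  by_cases hz : ‖z‖ ∈ T
  · rw [indicator_of_mem, indicator_of_mem (by exact hz), h, Real.mul_rpow hr.le (norm_nonneg _),
      ENNReal.ofReal_mul (by positivity)]
    show ‖x - (x + r • z)‖ / r ∈ T
    rwa [h, mul_div_cancel_left₀ _ hr.ne']
  · rw [indicator_of_notMem, indicator_of_notMem (by exact hz), mul_zero]
    show ‖x - (x + r • z)‖ / r ∉ T
    rwa [h, mul_div_cancel_left₀ _ hr.ne']

theorem exists_setLIntegral_ball_norm_rpow_le (hN : 1 ≤ N) {a : ℝ} (ha : -(N : ℝ) < a) :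
    ∃ C : ℝ, 0 < C ∧ ∀ (x : Rn N) (r : ℝ), 0 < r →
      ∫⁻ y in ball x r, ENNReal.ofReal (‖x - y‖ ^ a) ≤
        ENNReal.ofReal (C * r ^ ((N : ℝ) + a)) := by
  have hfin : ∫⁻ z in {z : Rn N | ‖z‖ ∈ Iio (1 : ℝ)}, ENNReal.ofReal (‖z‖ ^ a) < ∞ := by
    have : {z : Rn N | ‖z‖ ∈ Iio (1 : ℝ)} = ball 0 1 := by ext; simp
    rw [this]
    refine (integrableOn_ball_of_norm_le_rpow (C := 1) (α := -a) ?_ ?_ ?_ ?_).lintegral_lt_top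
    · simpa using hN
    · simp; linarith
    · refine .of_forall fun z => ?_
      rw [Real.norm_of_nonneg (by positivity), neg_neg, one_mul]
    · exact (by fun_prop : Measurable fun z : Rn N => ‖z‖ ^ a).aestronglyMeasurable
  set I := ∫⁻ z in {z : Rn N | ‖z‖ ∈ Iio (1 : ℝ)}, ENNReal.ofReal (‖z‖ ^ a)
  refine ⟨I.toReal + 1, by positivity, fun x r hr => ?_⟩
  have : ball x r = {y | ‖x - y‖ / r ∈ Iio (1 : ℝ)} := by
    ext y
    simp [div_lt_one hr, dist_eq_norm_sub']
  rw [this, setLIntegral_norm_rpow_scaling _ measurableSet_Iio _ _ hr, mul_comm,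
    ENNReal.ofReal_mul (by positivity)]
  gcongr
  exact (ENNReal.ofReal_toReal hfin.ne).symm.le.trans (ENNReal.ofReal_le_ofReal (by simp))

theorem exists_setLIntegral_compl_ball_norm_rpow_le {a : ℝ} (ha : a < -(N : ℝ)) :
    ∃ C : ℝ, 0 < C ∧ ∀ (x : Rn N) (r : ℝ), 0 < r →
      ∫⁻ y in (ball x r)ᶜ, ENNReal.ofReal (‖x - y‖ ^ a) ≤
        ENNReal.ofReal (C * r ^ ((N : ℝ) + a)) := by
  have ha0 : a ≤ 0 := by
    have : (0 : ℝ) ≤ N := by positivity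
    linarith
  have hfin : ∫⁻ z in {z : Rn N | ‖z‖ ∈ Ici (1 : ℝ)}, ENNReal.ofReal (‖z‖ ^ a) < ∞ := by
    have h1 : ∫⁻ z : Rn N, ENNReal.ofReal (2 ^ (-a)) * ENNReal.ofReal ((1 + ‖z‖) ^ (-(-a))) < ∞ := by
      rw [lintegral_const_mul _ (by fun_prop)]
      refine ENNReal.mul_lt_top ENNReal.ofReal_lt_top (finite_integral_one_add_norm ?_)
      simp; linarith
    refine lt_of_le_of_lt ?_ h1
    refine (setLIntegral_mono (by fun_prop) fun z hz => ?_).trans (setLIntegral_le_lintegral _ _)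
    have hz : 1 ≤ ‖z‖ := hz
    rw [← ENNReal.ofReal_mul (by positivity)]
    refine ENNReal.ofReal_le_ofReal ?_
    calc ‖z‖ ^ a = 2 ^ (-a) * (2 * ‖z‖) ^ a := by
          rw [Real.mul_rpow (by norm_num) (by positivity), ← mul_assoc,
            ← Real.rpow_add (by norm_num)]; simp
      _ ≤ 2 ^ (-a) * (1 + ‖z‖) ^ (-(-a)) := by
          rw [neg_neg]
          gcongr ?_ * ?_
          exact Real.rpow_le_rpow_of_nonpos (by positivity) (by linarith) ha0
  set I := ∫⁻ z in {z : Rn N | ‖z‖ ∈ Ici (1 : ℝ)}, ENNReal.ofReal (‖z‖ ^ a)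
  refine ⟨I.toReal + 1, by positivity, fun x r hr => ?_⟩
  have : (ball x r)ᶜ = {y | ‖x - y‖ / r ∈ Ici (1 : ℝ)} := by
    ext y
    simp [one_le_div hr, dist_eq_norm_sub']
  rw [this, setLIntegral_norm_rpow_scaling _ measurableSet_Ici _ _ hr, mul_comm,
    ENNReal.ofReal_mul (by positivity)]
  gcongr
  exact (ENNReal.ofReal_toReal hfin.ne).symm.le.trans (ENNReal.ofReal_le_ofReal (by simp))

/-- The complement of a set with small measure carries a large part of the singular kernel. -/
theorem le_setLIntegral_compl_one_div_norm_rpow (hN : 1 ≤ N) {d : ℝ} (hd : 0 ≤ d) {E : Set (Rn N)}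
    (x : Rn N) {r : ℝ}
    (hEr : volume E ≤ volume (ball x r) / 2) :
    ENNReal.ofReal (1 / r ^ d) * (volume (ball x r) / 2) ≤
      ∫⁻ y in Eᶜ, ENNReal.ofReal (1 / ‖x - y‖ ^ d) := by
  have : Nonempty (Fin N) := ⟨⟨0, hN⟩⟩
  have hb : volume (ball x r) ≠ ∞ := measure_ball_lt_top.ne
  -- The centre is removed because for `d > 0` the integrand has the value `1 / 0 = 0` there, which
  -- would break the pointwise lower bound.
  have h1 : volume (ball x r) / 2 ≤ volume ((ball x r \ E) \ {x}) := by
    rw [measure_sdiff_null (measure_singleton x)]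
    calc volume (ball x r) / 2 = volume (ball x r) - volume (ball x r) / 2 :=
          (ENNReal.sub_half hb).symm
      _ ≤ volume (ball x r) - volume E := by gcongr
      _ ≤ volume (ball x r \ E) := le_measure_sdiff
  calc ENNReal.ofReal (1 / r ^ d) * (volume (ball x r) / 2)
      ≤ ENNReal.ofReal (1 / r ^ d) * volume ((ball x r \ E) \ {x}) := by gcongr
    _ = ∫⁻ _ in (ball x r \ E) \ {x}, ENNReal.ofReal (1 / r ^ d) := by simp
    _ ≤ ∫⁻ y in (ball x r \ E) \ {x}, ENNReal.ofReal (1 / ‖x - y‖ ^ d) := by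
        refine setLIntegral_mono (by fun_prop) fun y hy => ?_
        refine ENNReal.ofReal_le_ofReal ?_
        have hyx : 0 < ‖x - y‖ := norm_pos_iff.2 (sub_ne_zero.2 (Ne.symm hy.2))
        have hyr : ‖x - y‖ ≤ r := by
          have := hy.1.1
          rw [mem_ball, dist_eq_norm_sub'] at this
          exact this.le
        gcongr
    _ ≤ _ := lintegral_mono_set fun y hy => hy.1.2

end RadialIntegrals

/-! ### Continuity of translations in Lebesgue spaces. -/

section Translation

variable {X : Type*} [NormedAddCommGroup X] [NormedSpace ℝ X] [FiniteDimensional ℝ X]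
  [MeasurableSpace X] [BorelSpace X]

theorem tendsto_eLpNorm_translate_sub (μ : Measure X) [μ.IsAddHaarMeasure] {q : ℝ≥0∞}
    (hq1 : 1 ≤ q) (hq : q ≠ ∞) {f : X → ℝ} (hf : MemLp f q μ) :
    Tendsto (fun v => eLpNorm ((fun z => f (z - v)) - f) q μ) (𝓝 0) (𝓝 0) := by
  have : Fact (1 ≤ q) := ⟨hq1⟩
  let F : C(X, C(X, X)) := ContinuousMap.curry ⟨fun a : X × X => a.2 - a.1, by fun_prop⟩
  have hmp : ∀ v, MeasurePreserving (F v) μ μ := fun v => measurePreserving_sub_right μ v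
  have key := Filter.Tendsto.compMeasurePreservingLp (p := q) (μ := μ) (ν := μ)
    (tendsto_const_nhds (x := hf.toLp f) (f := 𝓝 (0 : X)))
    (F.continuous.tendsto 0) hmp (hmp 0) hq
  rw [Lp.tendsto_Lp_iff_tendsto_eLpNorm'] at key
  refine key.congr fun v => eLpNorm_congr_ae ?_
  have e1 := Lp.coeFn_compMeasurePreserving (hf.toLp f) (hmp v)
  have e2 := Lp.coeFn_compMeasurePreserving (hf.toLp f) (hmp 0)
  have e3 := (hmp v).quasiMeasurePreserving.ae_eq_comp hf.coeFn_toLp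
  have e4 := (hmp 0).quasiMeasurePreserving.ae_eq_comp hf.coeFn_toLp
  filter_upwards [e1, e2, e3, e4] with z h1 h2 h3 h4
  simp only [Pi.sub_apply, h1, h2, h3, h4]
  simp [F]

/-- By Hölder, the error is at most `‖f(· - v) - f‖_q ‖g‖_{q'}`. The translated factor needs a
finite exponent, but `q = 1`, `q' = ∞` is allowed. -/
theorem tendsto_integral_translate_mul (μ : Measure X) [μ.IsAddHaarMeasure] {q q' : ℝ≥0∞}
    [q.HolderConjugate q'] (hq : q ≠ ∞) {f g : X → ℝ} (hf : MemLp f q μ) (hg : MemLp g q' μ) :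
    Tendsto (fun v => ∫ z, f (z - v) * g z ∂μ) (𝓝 0) (𝓝 (∫ z, f z * g z ∂μ)) := by
  have hq1 : 1 ≤ q := ENNReal.HolderConjugate.one_le q q'
  have hfv : ∀ v, MemLp (fun z => f (z - v)) q μ := fun v =>
    hf.comp_measurePreserving (measurePreserving_sub_right μ v)
  rw [tendsto_iff_edist_tendsto_0]
  refine tendsto_of_tendsto_of_tendsto_of_le_of_le tendsto_const_nhds
    (h := fun v => eLpNorm ((fun z => f (z - v)) - f) q μ * eLpNorm g q' μ) ?_
    (fun _ => zero_le) fun v => ?_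
  · have := ENNReal.Tendsto.mul_const (b := eLpNorm g q' μ)
      (tendsto_eLpNorm_translate_sub μ hq1 hq hf) (Or.inr hg.eLpNorm_ne_top)
    simpa using this
  · have h1 : Integrable (fun z => f (z - v) * g z) μ := (hfv v).integrable_mul hg
    have h2 : Integrable (fun z => f z * g z) μ := hf.integrable_mul hg
    simp only
    rw [edist_eq_enorm_sub, ← integral_sub h1 h2]
    refine (enorm_integral_le_lintegral_enorm _).trans ?_
    rw [← eLpNorm_one_eq_lintegral_enorm]
    refine le_trans (le_of_eq ?_) (eLpNorm_smul_le_mul_eLpNorm (p := q) (q := q') (r := 1)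
      hg.1 ((hfv v).sub hf).1)
    congr 1
    ext z
    simp [sub_mul]

end Translation

/-! ### Pointwise inequalities for the nonlinearity. -/

section RealInequalities

/-- Tangent line inequality for the convex function `t ↦ t^p` at `b`, obtained from Bernoulli's
inequality at `a / b - 1`. -/
theorem rpow_sub_rpow_le {p a b : ℝ} (hp : 1 ≤ p) (ha : 0 ≤ a) (hb : 0 ≤ b) :
    b ^ p - a ^ p ≤ p * b ^ (p - 1) * (b - a) := by
  rcases hb.eq_or_lt with rfl | hb
  · rcases hp.eq_or_lt with rfl | hp
    · simp
    · rw [Real.zero_rpow (by linarith), Real.zero_rpow (by linarith)]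
      simp; positivity
  · have h := one_add_mul_self_le_rpow_one_add (s := a / b - 1) (by
      have : 0 ≤ a / b := by positivity
      linarith) hp
    rw [add_sub_cancel, Real.div_rpow ha hb.le, le_div_iff₀ (by positivity)] at h
    have e : b ^ p = b ^ (p - 1) * b := by
      rw [← Real.rpow_add_one hb.ne']; simp
    have : (1 + p * (a / b - 1)) * b ^ p = b ^ p - p * b ^ (p - 1) * (b - a) := by
      rw [e]; field_simp; ring
    linarith

theorem abs_rpow_sub_rpow_le {p a b : ℝ} (hp : 1 ≤ p) (ha : a ∈ Icc (0 : ℝ) 1)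
    (hb : b ∈ Icc (0 : ℝ) 1) : |a ^ p - b ^ p| ≤ p * |a - b| := by
  have key : ∀ a b : ℝ, a ∈ Icc (0 : ℝ) 1 → b ∈ Icc (0 : ℝ) 1 → b ≤ a →
      |a ^ p - b ^ p| ≤ p * |a - b| := by
    intro a b ha hb hab
    rw [abs_of_nonneg (by linarith [Real.rpow_le_rpow hb.1 hab (by linarith : 0 ≤ p)]),
      abs_of_nonneg (by linarith)]
    refine (rpow_sub_rpow_le hp hb.1 ha.1).trans ?_
    have h1 : a ^ (p - 1) ≤ 1 := Real.rpow_le_one ha.1 ha.2 (by linarith)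
    have : 0 ≤ a - b := by linarith
    exact mul_le_mul_of_nonneg_right (by nlinarith) this
  rcases le_total b a with h | h
  · exact key a b ha hb h
  · rw [abs_sub_comm, abs_sub_comm a b]
    exact key b a hb ha h

/-- Passing through the maximum also covers `q < 1`, which occurs for `q = p - 1`. -/
theorem add_rpow_le_two_rpow_mul {q a b : ℝ} (hq : 0 ≤ q) (ha : 0 ≤ a) (hb : 0 ≤ b) :
    (a + b) ^ q ≤ 2 ^ q * (a ^ q + b ^ q) := by
  have h1 : a + b ≤ 2 * max a b := by linarith [le_max_left a b, le_max_right a b]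
  have h2 : (max a b) ^ q ≤ a ^ q + b ^ q := by
    have := Real.rpow_nonneg ha q
    have := Real.rpow_nonneg hb q
    rcases max_choice a b with h | h <;> rw [h] <;> linarith
  calc (a + b) ^ q ≤ (2 * max a b) ^ q := by gcongr
    _ = 2 ^ q * (max a b) ^ q := Real.mul_rpow (by norm_num) (le_max_of_le_left ha)
    _ ≤ _ := by gcongr

/-- The odd power `t ↦ |t|^{p-2} t`. -/
def oddPow (p t : ℝ) : ℝ := |t| ^ (p - 2) * t

theorem oddPow_of_nonneg {p t : ℝ} (hp : 1 < p) (ht : 0 ≤ t) : oddPow p t = t ^ (p - 1) := by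
  rw [oddPow, abs_of_nonneg ht]
  rcases ht.eq_or_lt with rfl | ht
  · rw [mul_zero, Real.zero_rpow (by linarith)]
  · rw [← Real.rpow_add_one ht.ne']; ring_nf

theorem oddPow_neg (p t : ℝ) : oddPow p (-t) = -oddPow p t := by
  simp [oddPow]

theorem oddPow_of_nonpos {p t : ℝ} (hp : 1 < p) (ht : t ≤ 0) :
    oddPow p t = -(-t) ^ (p - 1) := by
  rw [← oddPow_of_nonneg hp (by linarith), oddPow_neg, neg_neg]

theorem abs_oddPow {p : ℝ} (hp : 1 < p) (t : ℝ) : |oddPow p t| = |t| ^ (p - 1) := by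
  rcases le_total 0 t with h | h
  · rw [oddPow_of_nonneg hp h, abs_of_nonneg h, abs_of_nonneg (by positivity)]
  · rw [oddPow_of_nonpos hp h, abs_neg, abs_of_nonpos h,
      abs_of_nonneg (Real.rpow_nonneg (by linarith) _)]

theorem measurable_oddPow (p : ℝ) : Measurable (oddPow p) := by
  unfold oddPow; fun_prop

/-- The product can be negative only if `f > e`. Then convexity bounds it below by `T^{p-1} (T - c)`
with `T = (A - B) f` and `c = p A (f - e)`, and this is at least `-c^p`. Thus the only loss is the
variation of the cutoff. -/
theorem neg_rpow_le_mul_sub {p A B e f M : ℝ} (hp : 1 < p) (hB : 0 ≤ B) (hAB : B ≤ A)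
    (hAM : A ≤ M) (he : 0 ≤ e) (hf : 0 ≤ f) :
    -(p * M * |e - f|) ^ p ≤ (A - B) ^ (p - 1) * (A * e ^ p - B * f ^ p) := by
  have hA : 0 ≤ A := hB.trans hAB
  have hM : 0 ≤ M := hA.trans hAM
  have hd : 0 ≤ A - B := by linarith
  rcases le_total f e with hfe | hef
  · have h1 : f ^ p ≤ e ^ p := Real.rpow_le_rpow hf hfe (by linarith)
    have h2 : B * f ^ p ≤ A * e ^ p := by
      have := Real.rpow_nonneg hf p
      gcongr
    have h3 : 0 ≤ (A - B) ^ (p - 1) * (A * e ^ p - B * f ^ p) :=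
      mul_nonneg (Real.rpow_nonneg hd _) (by linarith)
    have h4 : 0 ≤ (p * M * |e - f|) ^ p := by positivity
    linarith
  · set T := (A - B) * f with hT
    set c := p * A * (f - e) with hc
    have hT0 : 0 ≤ T := by positivity
    have hc0 : 0 ≤ c := by
      have : 0 ≤ f - e := by linarith
      positivity
    have hcM : c ^ p ≤ (p * M * |e - f|) ^ p := by
      rw [abs_sub_comm, abs_of_nonneg (sub_nonneg.2 hef)]
      have : 0 ≤ f - e := by linarith
      refine Real.rpow_le_rpow hc0 ?_ (by linarith)
      rw [hc]
      gcongr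
    have pw : ∀ t : ℝ, 0 ≤ t → t ^ (p - 1) * t = t ^ p := fun t ht => by
      rw [← Real.rpow_add_one' ht (by linarith)]; simp
    have h1 : (A - B) ^ (p - 1) * (A * e ^ p - B * f ^ p) ≥ T ^ (p - 1) * (T - c) := by
      have h5 := rpow_sub_rpow_le hp.le he hf
      have h6 : A * e ^ p - B * f ^ p ≥ (A - B) * f ^ p - A * (p * f ^ (p - 1) * (f - e)) := by
        nlinarith
      calc T ^ (p - 1) * (T - c)
          = (A - B) ^ (p - 1) * ((A - B) * f ^ p - A * (p * f ^ (p - 1) * (f - e))) := by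
            rw [hT, Real.mul_rpow hd hf, ← pw f hf, hc]; ring
        _ ≤ _ := mul_le_mul_of_nonneg_left h6 (Real.rpow_nonneg hd _)
    have h2 : -c ^ p ≤ T ^ (p - 1) * (T - c) := by
      rcases le_total c T with h | h
      · have : 0 ≤ T ^ (p - 1) * (T - c) := mul_nonneg (by positivity) (by linarith)
        have : 0 ≤ c ^ p := by positivity
        linarith
      · have h7 : T ^ (p - 1) ≤ c ^ (p - 1) := Real.rpow_le_rpow hT0 h (by linarith)
        rw [← pw c hc0]
        have h8 : 0 ≤ T ^ (p - 1) := by positivity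
        nlinarith
    linarith

/-- Interaction of two points below the level `l`; `e` and `f` are the values of the cutoff. -/
theorem oddPow_mul_le_of_lt_of_lt {p a b e f l M : ℝ} (hp : 1 < p) (ha : a ≤ l) (hb : b ≤ l)
    (haM : l - a ≤ M) (hbM : l - b ≤ M) (he : 0 ≤ e) (hf : 0 ≤ f) :
    oddPow p (a - b) * ((l - a) * e ^ p - (l - b) * f ^ p) ≤ (p * M * |e - f|) ^ p := by
  rcases le_total a b with h | h
  · have := neg_rpow_le_mul_sub hp (sub_nonneg.2 hb) (sub_le_sub_left h l) haM he hf
    rw [oddPow_of_nonpos hp (by linarith)]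
    have e1 : l - a - (l - b) = -(a - b) := by ring
    rw [e1] at this
    linarith
  · have := neg_rpow_le_mul_sub hp (sub_nonneg.2 ha) (sub_le_sub_left h l) hbM hf he
    rw [oddPow_of_nonneg hp (by linarith), abs_sub_comm]
    have e1 : l - b - (l - a) = a - b := by ring
    rw [e1] at this
    linarith

theorem oddPow_mul_le_neg {p a b e l : ℝ} (hp : 1 < p) (ha : a ≤ l) (hb : l ≤ b) (he : 0 ≤ e) :
    oddPow p (a - b) * ((l - a) * e) ≤ -((l - a) ^ p * e) := by
  rw [oddPow_of_nonpos hp (by linarith)]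
  have h0 : 0 ≤ l - a := by linarith
  have h1 : (l - a) ^ (p - 1) ≤ (-(a - b)) ^ (p - 1) :=
    Real.rpow_le_rpow h0 (by linarith) (by linarith)
  have h2 : (l - a) ^ p = (l - a) ^ (p - 1) * (l - a) := by
    rw [← Real.rpow_add_one' h0 (by linarith)]; simp
  rw [h2]
  have : 0 ≤ (l - a) * e := by positivity
  nlinarith

/-- Interaction with an exterior point, where the value `b` has no sign. Only its negative part can
make the term large, and this is where the tail enters. -/
theorem oddPow_mul_le_of_nonneg {p a b t k : ℝ} (hp : 1 < p) (ha0 : 0 ≤ a) (hak : a ≤ k)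
    (ht0 : 0 ≤ t) (htk : t ≤ k) :
    oddPow p (a - b) * t ≤ (k + b⁻) ^ (p - 1) * k := by
  have hk : 0 ≤ k := ha0.trans hak
  have hb := negPart_nonneg b
  rcases le_total a b with h | h
  · rw [oddPow_of_nonpos hp (by linarith)]
    have : 0 ≤ (-(a - b)) ^ (p - 1) := Real.rpow_nonneg (by linarith) _
    have : 0 ≤ (k + b⁻) ^ (p - 1) * k := by positivity
    nlinarith
  · rw [oddPow_of_nonneg hp (by linarith)]
    have : -b ≤ b⁻ := neg_le_negPart b
    have h1 : (a - b) ^ (p - 1) ≤ (k + b⁻) ^ (p - 1) :=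
      Real.rpow_le_rpow (by linarith) (by linarith) (by linarith)
    have : 0 ≤ (a - b) ^ (p - 1) := Real.rpow_nonneg (by linarith) _
    gcongr

end RealInequalities

/-! ### Kernel bounds and measure on the product space. -/

section Product

variable {N : ℕ}

instance : (volume : Measure (Rn N × Rn N)).IsAddHaarMeasure :=
  inferInstanceAs ((volume : Measure (Rn N)).prod volume).IsAddHaarMeasure

theorem setLIntegral_prod_swap (S T : Set (Rn N)) (f : Rn N × Rn N → ℝ≥0∞) :
    ∫⁻ z in S ×ˢ T, f z.swap = ∫⁻ z in T ×ˢ S, f z := by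
  have h := (Measure.measurePreserving_swap (μ := (volume : Measure (Rn N)))
    (ν := (volume : Measure (Rn N))))
  have := h.setLIntegral_comp_preimage_emb MeasurableEquiv.prodComm.measurableEmbedding f (T ×ˢ S)
  rw [← Measure.volume_eq_prod, preimage_swap_prod] at this
  exact this

theorem IsKernel.ae_bounds {p s Λ₁ Λ₂ : ℝ} {K : Rn N → Rn N → ℝ} (hΛ : 0 < Λ₁)
    (hd : (N : ℝ) + p * s ≠ 0) (hK : IsKernel p s Λ₁ Λ₂ K) :
    ∀ᵐ z : Rn N × Rn N, 0 < ‖z.1 - z.2‖ ∧ Λ₁ * (1 / ‖z.1 - z.2‖ ^ ((N : ℝ) + p * s)) ≤ K z.1 z.2 ∧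
      K z.1 z.2 ≤ Λ₂ * (1 / ‖z.1 - z.2‖ ^ ((N : ℝ) + p * s)) := by
  filter_upwards [hK.bounds] with z hz
  -- On the diagonal the lower kernel bound would read `Λ₁ ≤ K * 0`, so the bounds themselves
  -- exclude it.
  have h0 : 0 < ‖z.1 - z.2‖ := by
    refine (norm_nonneg _).lt_of_ne fun h => ?_
    rw [← h, Real.zero_rpow hd] at hz
    linarith [hz.1]
  have h1 : 0 < ‖z.1 - z.2‖ ^ ((N : ℝ) + p * s) := by positivity
  refine ⟨h0, ?_, ?_⟩
  · rw [mul_one_div, div_le_iff₀ h1]; exact hz.1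
  · rw [mul_one_div, le_div_iff₀ h1]; exact hz.2

theorem lintegral_ball_prod_compl_ball_lt_top {d : ℝ} (hd : (N : ℝ) < d) (x₀ : Rn N) {r R : ℝ}
    (hr : r < R) :
    ∫⁻ z in ball x₀ r ×ˢ (ball x₀ R)ᶜ, ENNReal.ofReal (1 / ‖z.1 - z.2‖ ^ d) < ∞ := by
  obtain ⟨C, -, hC⟩ := exists_setLIntegral_compl_ball_norm_rpow_le (N := N) (a := -d) (by linarith)
  rw [Measure.volume_eq_prod, setLIntegral_prod _ (by fun_prop)]
  calc ∫⁻ x in ball x₀ r, ∫⁻ y in (ball x₀ R)ᶜ, ENNReal.ofReal (1 / ‖x - y‖ ^ d)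
      ≤ ∫⁻ _ in ball x₀ r, ENNReal.ofReal (C * (R - r) ^ ((N : ℝ) + -d)) := by
        refine setLIntegral_mono (by fun_prop) fun x hx => ?_
        refine le_trans ?_ (hC x (R - r) (by linarith))
        simp only [one_div, Real.rpow_neg (norm_nonneg _)]
        refine lintegral_mono_set fun y hy => ?_
        simp only [mem_compl_iff, mem_ball, not_lt] at hx hy ⊢
        linarith [dist_triangle y x x₀]
    _ < ∞ := by
        rw [setLIntegral_const]
        exact ENNReal.mul_lt_top ENNReal.ofReal_lt_top measure_ball_lt_top

end Product

/-! ### Integrability of the weak form against rough test functions. -/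

/-- A measurable function whose Gagliardo energy in a ball and whose nonlocal interaction between
smaller balls and the exterior are finite. -/
structure HasFiniteEnergy {N : ℕ} (p d : ℝ) (v : Rn N → ℝ) (x₀ : Rn N) (R : ℝ) : Prop where
  measurable : Measurable v
  inner : ∫⁻ z in ball x₀ R ×ˢ ball x₀ R,
    ENNReal.ofReal (|v z.1 - v z.2| ^ p / ‖z.1 - z.2‖ ^ d) < ∞
  outer : ∀ r < R, ∫⁻ z in ball x₀ r ×ˢ (ball x₀ R)ᶜ,
    ENNReal.ofReal (|v z.1 - v z.2| ^ (p - 1) / ‖z.1 - z.2‖ ^ d) < ∞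

/-- Bounded nonnegative functions of finite Gagliardo energy supported in a ball. -/
structure IsRoughTestFunction {N : ℕ} (p d M : ℝ) (φ : Rn N → ℝ) (x₀ : Rn N) (r R : ℝ) :
    Prop where
  measurable : Measurable φ
  nonneg : ∀ x, 0 ≤ φ x
  le : ∀ x, φ x ≤ M
  eq_zero : ∀ x, x ∉ ball x₀ r → φ x = 0
  inner : ∫⁻ z in ball x₀ R ×ˢ ball x₀ R,
    ENNReal.ofReal (|φ z.1 - φ z.2| ^ p / ‖z.1 - z.2‖ ^ d) < ∞

variable {N : ℕ} {p d M : ℝ} {v φ : Rn N → ℝ} {x₀ : Rn N} {r R : ℝ}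

theorem lintegral_lt_top_of_eq_zero_off_union {X : Type*} [MeasurableSpace X] {μ : Measure X}
    {f : X → ℝ≥0∞} {S T U : Set X} (h : ∀ z, z ∉ S → z ∉ T → z ∉ U → f z = 0)
    (hS : ∫⁻ z in S, f z ∂μ < ∞) (hT : ∫⁻ z in T, f z ∂μ < ∞) (hU : ∫⁻ z in U, f z ∂μ < ∞) :
    ∫⁻ z, f z ∂μ < ∞ := by
  have h1 : ∫⁻ z, f z ∂μ = ∫⁻ z in S ∪ T ∪ U, f z ∂μ := by
    refine (setLIntegral_eq_of_support_subset fun z hz => ?_).symm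
    by_contra hz'
    simp only [mem_union, not_or] at hz'
    exact hz (h z hz'.1.1 hz'.1.2 hz'.2)
  rw [h1]
  exact ((lintegral_union_le _ _ _).trans (add_le_add_left (lintegral_union_le _ _ _) _)).trans_lt
    (ENNReal.add_lt_top.2 ⟨ENNReal.add_lt_top.2 ⟨hS, hT⟩, hU⟩)

theorem IsRoughTestFunction.sub_eq_zero (h : IsRoughTestFunction p d M φ x₀ r R) (hr : r ≤ R)
    {z : Rn N × Rn N} (h1 : z ∉ ball x₀ R ×ˢ ball x₀ R) (h2 : z ∉ ball x₀ r ×ˢ (ball x₀ R)ᶜ)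
    (h3 : z ∉ (ball x₀ R)ᶜ ×ˢ ball x₀ r) : φ z.1 - φ z.2 = 0 := by
  have hsub : ball x₀ r ⊆ ball x₀ R := ball_subset_ball hr
  simp only [mem_prod, mem_compl_iff, not_and, not_not] at h1 h2 h3
  rw [h.eq_zero z.1 fun hx => h1 (hsub hx) (h2 hx),
    h.eq_zero z.2 fun hy => by
      by_cases hx : z.1 ∈ ball x₀ R
      · exact h1 hx (hsub hy)
      · exact h3 hx hy, sub_zero]

theorem IsRoughTestFunction.lintegral_lt_top (hp : 0 < p) (hd : (N : ℝ) < d) (hr : r < R)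
    (h : IsRoughTestFunction p d M φ x₀ r R) :
    ∫⁻ z : Rn N × Rn N, ENNReal.ofReal (|φ z.1 - φ z.2| ^ p / ‖z.1 - z.2‖ ^ d) < ∞ := by
  have hM : 0 ≤ M := (h.nonneg 0).trans (h.le 0)
  have hout : ∫⁻ z in ball x₀ r ×ˢ (ball x₀ R)ᶜ,
      ENNReal.ofReal (|φ z.1 - φ z.2| ^ p / ‖z.1 - z.2‖ ^ d) < ∞ := by
    refine lt_of_le_of_lt (b := ENNReal.ofReal (M ^ p) *
      ∫⁻ z in ball x₀ r ×ˢ (ball x₀ R)ᶜ, ENNReal.ofReal (1 / ‖z.1 - z.2‖ ^ d)) ?_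
      (ENNReal.mul_lt_top ENNReal.ofReal_lt_top (lintegral_ball_prod_compl_ball_lt_top hd x₀ hr))
    rw [← lintegral_const_mul _ (by fun_prop)]
    refine lintegral_mono fun z => ?_
    rw [← ENNReal.ofReal_mul (by positivity)]
    refine ENNReal.ofReal_le_ofReal ?_
    rw [mul_one_div]
    gcongr
    rw [abs_le]
    constructor <;> linarith [h.nonneg z.1, h.nonneg z.2, h.le z.1, h.le z.2]
  have hout' : ∫⁻ z in (ball x₀ R)ᶜ ×ˢ ball x₀ r,
      ENNReal.ofReal (|φ z.1 - φ z.2| ^ p / ‖z.1 - z.2‖ ^ d) < ∞ := by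
    rw [← setLIntegral_prod_swap]
    simpa only [Prod.fst_swap, Prod.snd_swap, abs_sub_comm, norm_sub_rev] using hout
  refine lintegral_lt_top_of_eq_zero_off_union (fun z h1 h2 h3 => ?_) h.inner hout hout'
  rw [h.sub_eq_zero hr.le h1 h2 h3]
  simp [Real.zero_rpow hp.ne']

/-- The factor of the weak form that does not depend on the test function. -/
def flux (p : ℝ) (K : Rn N → Rn N → ℝ) (v : Rn N → ℝ) (z : Rn N × Rn N) : ℝ :=
  oddPow p (v z.1 - v z.2) * K z.1 z.2

theorem weakForm_eq_integral_flux (K : Rn N → Rn N → ℝ) (v φ : Rn N → ℝ) :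
    weakForm p K v φ = ∫ z, flux p K v z * (φ z.1 - φ z.2) := by
  unfold weakForm flux oddPow
  congr 1
  ext z
  ring

variable {s Λ₁ Λ₂ : ℝ} {K : Rn N → Rn N → ℝ}

theorem aestronglyMeasurable_flux (hv : Measurable v) (hK : IsKernel p s Λ₁ Λ₂ K) :
    AEStronglyMeasurable (flux p K v) volume := by
  have h1 : Measurable fun z : Rn N × Rn N => oddPow p (v z.1 - v z.2) :=
    (measurable_oddPow p).comp (by fun_prop)
  exact (h1.aemeasurable.mul hK.aemeasurable).aestronglyMeasurable

theorem ae_abs_flux_le (hp : 1 < p) (hΛ : 0 < Λ₁) (hd : (N : ℝ) + p * s ≠ 0)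
    (hK : IsKernel p s Λ₁ Λ₂ K) :
    ∀ᵐ z : Rn N × Rn N, |flux p K v z| ≤
      Λ₂ * (|v z.1 - v z.2| ^ (p - 1) / ‖z.1 - z.2‖ ^ ((N : ℝ) + p * s)) := by
  filter_upwards [hK.ae_bounds hΛ hd] with z hz
  have : 0 ≤ K z.1 z.2 := le_trans (by positivity) hz.2.1
  rw [flux, abs_mul, abs_oddPow hp, abs_of_nonneg this]
  calc |v z.1 - v z.2| ^ (p - 1) * K z.1 z.2
      ≤ |v z.1 - v z.2| ^ (p - 1) * (Λ₂ * (1 / ‖z.1 - z.2‖ ^ ((N : ℝ) + p * s))) := by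
        gcongr; exact hz.2.2
    _ = _ := by ring

theorem integrable_indicator_flux_outer (hp : 1 < p) (hΛ : 0 < Λ₁) (hd : (N : ℝ) + p * s ≠ 0)
    (hK : IsKernel p s Λ₁ Λ₂ K) (hv : HasFiniteEnergy p ((N : ℝ) + p * s) v x₀ R) (hr : r < R) :
    Integrable ((ball x₀ r ×ˢ (ball x₀ R)ᶜ).indicator (flux p K v)) ∧
    Integrable (((ball x₀ R)ᶜ ×ˢ ball x₀ r).indicator (flux p K v)) := by
  have hm := hv.measurable
  have key : ∀ S : Set (Rn N × Rn N), MeasurableSet S →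
      ∫⁻ z in S, ENNReal.ofReal (|v z.1 - v z.2| ^ (p - 1) / ‖z.1 - z.2‖ ^ ((N : ℝ) + p * s)) < ∞ →
      Integrable (S.indicator (flux p K v)) := by
    intro S hS hfin
    rw [integrable_indicator_iff hS]
    refine Integrable.mono' (g := fun z => Λ₂ * (|v z.1 - v z.2| ^ (p - 1) /
      ‖z.1 - z.2‖ ^ ((N : ℝ) + p * s))) (Integrable.const_mul ?_ _)
      (aestronglyMeasurable_flux hm hK).restrict
      (ae_restrict_of_ae (ae_abs_flux_le hp hΛ hd hK))
    refine ⟨(by fun_prop : Measurable _).aestronglyMeasurable, ?_⟩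
    rw [hasFiniteIntegral_iff_ofReal (.of_forall fun z => by positivity)]
    exact hfin
  constructor
  · exact key _ (measurableSet_ball.prod measurableSet_ball.compl) (hv.outer r hr)
  · refine key _ (measurableSet_ball.compl.prod measurableSet_ball) ?_
    rw [← setLIntegral_prod_swap]
    simpa only [Prod.fst_swap, Prod.snd_swap, abs_sub_comm, norm_sub_rev] using hv.outer r hr

/-- Near the diagonal the flux need not be integrable. Split the kernel as `|x - y|^{-d} = |x -
y|^{-d/q} |x - y|^{-d/p}` with `q` conjugate to `p`: since `(p - 1) q = p`, the `q`-th power of the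
first part is bounded by the energy density of `v`. The remaining weight goes to the test function
in `IsRoughTestFunction.memLp`. -/
theorem memLp_indicator_flux_inner (hp : 1 < p) (hΛ : 0 < Λ₁) (hd : (N : ℝ) + p * s ≠ 0)
    (hK : IsKernel p s Λ₁ Λ₂ K) (hv : HasFiniteEnergy p ((N : ℝ) + p * s) v x₀ R) :
    MemLp ((ball x₀ R ×ˢ ball x₀ R).indicator fun z =>
      flux p K v z * ‖z.1 - z.2‖ ^ (((N : ℝ) + p * s) / p))
      (ENNReal.ofReal (Real.conjExponent p)) volume := by
  set d := (N : ℝ) + p * s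
  have hm := hv.measurable
  set q := Real.conjExponent p with hq
  have hpq : p.HolderConjugate q := Real.HolderConjugate.conjExponent hp
  have hq0 : 0 < q := hpq.symm.pos
  have hS : MeasurableSet (ball x₀ R ×ˢ ball x₀ R) := measurableSet_ball.prod measurableSet_ball
  rw [memLp_indicator_iff_restrict hS]
  have hmeas : AEStronglyMeasurable (fun z : Rn N × Rn N =>
      flux p K v z * ‖z.1 - z.2‖ ^ (d / p)) volume :=
    (aestronglyMeasurable_flux hm hK).mul
      (by fun_prop : Measurable fun z : Rn N × Rn N => ‖z.1 - z.2‖ ^ (d / p)).aestronglyMeasurable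
  rw [← integrable_norm_rpow_iff hmeas.restrict (by simpa using hq0) ENNReal.ofReal_ne_top,
    ENNReal.toReal_ofReal hq0.le]
  refine Integrable.mono' (g := fun z => Λ₂ ^ q * (|v z.1 - v z.2| ^ p / ‖z.1 - z.2‖ ^ d))
    (Integrable.const_mul ⟨(by fun_prop : Measurable _).aestronglyMeasurable, ?_⟩ _)
    (hmeas.restrict.norm.aemeasurable.pow_const q).aestronglyMeasurable
    (ae_restrict_of_ae ?_)
  · rw [hasFiniteIntegral_iff_ofReal (.of_forall fun z => by positivity)]
    exact hv.inner
  · filter_upwards [ae_abs_flux_le (v := v) hp hΛ hd hK, hK.ae_bounds hΛ hd] with z h1 h2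
    have h0 := h2.1
    have hd0 : 0 < ‖z.1 - z.2‖ ^ d := by positivity
    have hΛ₂ : 0 ≤ Λ₂ := by
      have h3 := h2.2.1.trans h2.2.2
      have : 0 < Λ₁ * (1 / ‖z.1 - z.2‖ ^ d) := by positivity
      exact (pos_of_mul_pos_left (this.trans_le h3) (by positivity)).le
    rw [Real.norm_of_nonneg (by positivity), norm_mul, Real.norm_eq_abs,
      Real.norm_of_nonneg (by positivity : 0 ≤ ‖z.1 - z.2‖ ^ (d / p))]
    calc (|flux p K v z| * ‖z.1 - z.2‖ ^ (d / p)) ^ q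
        ≤ (Λ₂ * (|v z.1 - v z.2| ^ (p - 1) / ‖z.1 - z.2‖ ^ d) * ‖z.1 - z.2‖ ^ (d / p)) ^ q := by
          gcongr
      _ = (Λ₂ * (|v z.1 - v z.2| ^ (p - 1) / ‖z.1 - z.2‖ ^ (d / q))) ^ q := by
          have : ‖z.1 - z.2‖ ^ d = ‖z.1 - z.2‖ ^ (d / q) * ‖z.1 - z.2‖ ^ (d / p) := by
            rw [← Real.rpow_add h0]
            congr 1
            have := hpq.inv_add_inv_eq_one
            rw [div_eq_mul_inv, div_eq_mul_inv, ← mul_add, add_comm, this, mul_one]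
          rw [this, mul_assoc]
          congr 2
          have : 0 < ‖z.1 - z.2‖ ^ (d / p) := by positivity
          field_simp
      _ = Λ₂ ^ q * (|v z.1 - v z.2| ^ p / ‖z.1 - z.2‖ ^ d) := by
          rw [Real.mul_rpow hΛ₂ (by positivity), Real.div_rpow (by positivity) (by positivity),
            ← Real.rpow_mul (abs_nonneg _), ← Real.rpow_mul h0.le, div_mul_cancel₀ _ hq0.ne',
            hpq.sub_one_mul_conj]

theorem IsRoughTestFunction.memLp (hp : 0 < p) (hd : (N : ℝ) < d) (hr : r < R)
    (h : IsRoughTestFunction p d M φ x₀ r R) :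
    MemLp (fun z : Rn N × Rn N => (φ z.1 - φ z.2) / ‖z.1 - z.2‖ ^ (d / p)) (ENNReal.ofReal p)
      volume := by
  have hm := h.measurable
  have hmeas : AEStronglyMeasurable (fun z : Rn N × Rn N =>
      (φ z.1 - φ z.2) / ‖z.1 - z.2‖ ^ (d / p)) volume :=
    (by fun_prop : Measurable _).aestronglyMeasurable
  rw [← integrable_norm_rpow_iff hmeas (by simpa using hp) ENNReal.ofReal_ne_top,
    ENNReal.toReal_ofReal hp.le]
  have e : (fun z : Rn N × Rn N => ‖(φ z.1 - φ z.2) / ‖z.1 - z.2‖ ^ (d / p)‖ ^ p) =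
      fun z => |φ z.1 - φ z.2| ^ p / ‖z.1 - z.2‖ ^ d := by
    ext z
    rw [norm_div, Real.norm_eq_abs, Real.norm_of_nonneg (by positivity : 0 ≤ ‖z.1 - z.2‖ ^ (d / p)),
      Real.div_rpow (by positivity) (by positivity), ← Real.rpow_mul (norm_nonneg _),
      div_mul_cancel₀ _ hp.ne']
  rw [e]
  refine ⟨(by fun_prop : Measurable _).aestronglyMeasurable, ?_⟩
  rw [hasFiniteIntegral_iff_ofReal (.of_forall fun z => by positivity)]
  exact h.lintegral_lt_top hp hd hr

/-! ### From smooth to rough test functions. -/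

section TestFunctionExtension

variable {N : ℕ} {p d M : ℝ} {v φ : Rn N → ℝ} {x₀ : Rn N} {r R : ℝ}
  {s Λ₁ Λ₂ : ℝ} {K : Rn N → Rn N → ℝ}

/-- The diagonal shift `(h, h)` preserves `x - y`, so the inner part is a translate of one fixed
`L^p` function times a fixed `L^q` function. The two outer parts pair a fixed integrable function
with a bounded translate. -/
theorem IsRoughTestFunction.flux_mul_translate_eq (F : Rn N × Rn N → ℝ)
    (hφ : IsRoughTestFunction p d M φ x₀ r R) {r₁ : ℝ} {h : Rn N} (h1 : r + ‖h‖ ≤ r₁)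
    (h2 : r₁ ≤ R) (a : ℝ) (z : Rn N × Rn N) :
    F z * (φ (z.1 - h) - φ (z.2 - h)) =
      ((φ ((z - (h, h)).1) - φ ((z - (h, h)).2)) / ‖(z - (h, h)).1 - (z - (h, h)).2‖ ^ a) *
        (ball x₀ R ×ˢ ball x₀ R).indicator (fun z => F z * ‖z.1 - z.2‖ ^ a) z +
      (ball x₀ r₁ ×ˢ (ball x₀ R)ᶜ).indicator F z * φ (z.1 - h) -
      ((ball x₀ R)ᶜ ×ˢ ball x₀ r₁).indicator F z * φ (z.2 - h) := by
  have hz : ∀ x, x ∉ ball x₀ r₁ → φ (x - h) = 0 := fun x hx => by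
    refine hφ.eq_zero _ fun hx' => hx ?_
    rw [mem_ball, dist_eq_norm] at *
    have : x - x₀ = (x - h - x₀) + h := by abel
    rw [this]
    linarith [norm_add_le (x - h - x₀) h]
  have hsub : ball x₀ r₁ ⊆ ball x₀ R := ball_subset_ball h2
  obtain ⟨x, y⟩ := z
  have e : ((x, y) - (h, h)).1 - ((x, y) - (h, h)).2 = x - y := by simp
  rw [e]
  simp only [Prod.mk_sub_mk]
  classical
  simp only [indicator_apply, mem_prod, mem_compl_iff]
  by_cases hx : x ∈ ball x₀ R <;> by_cases hy : y ∈ ball x₀ R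
  · simp only [hx, hy, not_true_eq_false, and_self, and_false, false_and, if_true, if_false]
    rcases eq_or_ne x y with rfl | hne
    · simp
    · have : 0 < ‖x - y‖ := norm_pos_iff.2 (sub_ne_zero.2 hne)
      have : 0 < ‖x - y‖ ^ a := by positivity
      field_simp
      ring
  · have hy' := hz y fun H => hy (hsub H)
    by_cases hx' : x ∈ ball x₀ r₁
    · simp only [hx, hy, hx', hy', not_true_eq_false, not_false_eq_true, and_self, and_false,
        false_and, if_true, if_false]
      ring
    · simp only [hx, hy, hx', hy', hz x hx', not_true_eq_false, not_false_eq_true, 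
        and_false, false_and, if_false]
      ring
  · have hx' := hz x fun H => hx (hsub H)
    by_cases hy' : y ∈ ball x₀ r₁
    · simp only [hx, hy, hx', hy', not_true_eq_false, not_false_eq_true, and_self, and_false,
        false_and, if_true, if_false]
      ring
    · simp only [hx, hy, hx', hy', hz y hy', not_true_eq_false, not_false_eq_true,
        and_false, false_and, if_false]
      ring
  · rw [hz x (fun H => hx (hsub H)), hz y (fun H => hy (hsub H))]
    simp

theorem IsRoughTestFunction.abs_le (hφ : IsRoughTestFunction p d M φ x₀ r R) (x : Rn N) :
    |φ x| ≤ M := by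
  rw [abs_of_nonneg (hφ.nonneg x)]; exact hφ.le x

theorem IsRoughTestFunction.memLp_top_comp (hφ : IsRoughTestFunction p d M φ x₀ r R)
    {X : Type*} [MeasurableSpace X] {μ : Measure X} {g : X → Rn N} (hg : Measurable g) :
    MemLp (fun z => φ (g z)) ∞ μ :=
  memLp_top_of_bound (hφ.measurable.comp hg).aestronglyMeasurable M
    (.of_forall fun z => hφ.abs_le (g z))

/-- An integrable function is paired continuously with translates of a bounded function. -/
theorem tendsto_integral_mul_translate_of_bounded (hφ : IsRoughTestFunction p d M φ x₀ r R)
    {H : Rn N × Rn N → ℝ} (hH : Integrable H) (π : Rn N × Rn N →L[ℝ] Rn N)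
    (ι : Rn N →L[ℝ] Rn N × Rn N) (hπι : ∀ x, π (ι x) = x) :
    Tendsto (fun h => ∫ z, H z * φ (π z - h)) (𝓝 0) (𝓝 (∫ z, H z * φ (π z))) := by
  have h1 := tendsto_integral_translate_mul (volume : Measure (Rn N × Rn N)) (q := 1) (q' := ∞)
    -- Translations are not continuous in `L^∞`, so the shift is moved from `φ` to the integrable
    -- factor `H`.
    ENNReal.one_ne_top (memLp_one_iff_integrable.2 hH)
    (hφ.memLp_top_comp (μ := volume) π.measurable)
  have h2 : Tendsto (fun h : Rn N => -ι h) (𝓝 0) (𝓝 0) := by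
    have : Continuous fun h : Rn N => -ι h := by fun_prop
    simpa using this.tendsto 0
  refine (h1.comp h2).congr fun h => ?_
  simp only [Function.comp_apply]
  rw [← integral_sub_right_eq_self (μ := (volume : Measure (Rn N × Rn N)))
    (fun z => H z * φ (π z - h)) (-ι h)]
  simp [hπι]

/-- The uniform `L¹` bound `C` will justify Fubini for the mollification, and the limit will
transfer the sign of the weak form. -/
theorem IsRoughTestFunction.eventually_translate (hp : 1 < p) (hΛ : 0 < Λ₁)
    (hd : (N : ℝ) < (N : ℝ) + p * s) (hK : IsKernel p s Λ₁ Λ₂ K)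
    (hv : HasFiniteEnergy p ((N : ℝ) + p * s) v x₀ R) (hr : r < R)
    (hφ : IsRoughTestFunction p ((N : ℝ) + p * s) M φ x₀ r R) :
    ∃ C : ℝ, (∀ᶠ h in 𝓝 (0 : Rn N),
        Integrable (fun z => flux p K v z * (φ (z.1 - h) - φ (z.2 - h))) ∧
        ∫ z, ‖flux p K v z * (φ (z.1 - h) - φ (z.2 - h))‖ ≤ C) ∧
      Tendsto (fun h => ∫ z, flux p K v z * (φ (z.1 - h) - φ (z.2 - h))) (𝓝 0)
        (𝓝 (∫ z, flux p K v z * (φ z.1 - φ z.2))) := by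
  set d := (N : ℝ) + p * s
  have hd0 : d ≠ 0 := by
    have : (0 : ℝ) ≤ N := by positivity
    linarith
  have hp0 : 0 < p := by linarith
  have hpq : p.HolderConjugate (Real.conjExponent p) := Real.HolderConjugate.conjExponent hp
  have : (ENNReal.ofReal p).HolderConjugate (ENNReal.ofReal (Real.conjExponent p)) :=
    hpq.ennrealOfReal
  -- An intermediate radius that contains the supports of all translates by less than `(R - r) / 2`
  -- and still stays away from the complement of the ball of radius `R`.
  set r₁ := (r + R) / 2 with hr₁
  have hr₁R : r₁ < R := by rw [hr₁]; linarith
  set F := flux p K v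
  set Φ : Rn N × Rn N → ℝ := fun z => (φ z.1 - φ z.2) / ‖z.1 - z.2‖ ^ (d / p)
  set H₁ := (ball x₀ R ×ˢ ball x₀ R).indicator fun z => F z * ‖z.1 - z.2‖ ^ (d / p)
  set H₂ := (ball x₀ r₁ ×ˢ (ball x₀ R)ᶜ).indicator F
  set H₃ := ((ball x₀ R)ᶜ ×ˢ ball x₀ r₁).indicator F
  have hΦ : MemLp Φ (ENNReal.ofReal p) volume := hφ.memLp hp0 hd hr
  have hH₁ : MemLp H₁ (ENNReal.ofReal (Real.conjExponent p)) volume :=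
    memLp_indicator_flux_inner hp hΛ hd0 hK hv
  obtain ⟨hH₂, hH₃⟩ : Integrable H₂ ∧ Integrable H₃ := integrable_indicator_flux_outer hp hΛ hd0 hK hv hr₁R
  have heq : ∀ h : Rn N, ‖h‖ < (R - r) / 2 → ∀ z, F z * (φ (z.1 - h) - φ (z.2 - h)) =
      Φ (z - (h, h)) * H₁ z + H₂ z * φ (z.1 - h) - H₃ z * φ (z.2 - h) := fun h hh z =>
    hφ.flux_mul_translate_eq F (by rw [hr₁]; linarith) hr₁R.le (d / p) z
  have hΦh : ∀ h : Rn N, MemLp (fun z => Φ (z - (h, h))) (ENNReal.ofReal p) volume := fun h =>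
    hΦ.comp_measurePreserving (measurePreserving_sub_right volume (h, h))
  have i1 : ∀ h : Rn N, Integrable (fun z => Φ (z - (h, h)) * H₁ z) := fun h =>
    (hΦh h).integrable_mul hH₁
  have hc : Tendsto (fun h : Rn N => (h, h)) (𝓝 0) (𝓝 0) := by
    have : Continuous fun h : Rn N => (h, h) := by fun_prop
    exact this.tendsto 0
  have ib : ∀ {H : Rn N × Rn N → ℝ}, Integrable H → ∀ {g : Rn N × Rn N → Rn N}, Measurable g →
      Integrable (fun z => H z * φ (g z)) := fun hH g hg =>
    hH.mul_bdd (c := M) (hφ.measurable.comp hg).aestronglyMeasurable (.of_forall fun z => hφ.abs_le (g z))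
  have bb : ∀ {H : Rn N × Rn N → ℝ}, Integrable H → ∀ {g : Rn N × Rn N → Rn N}, Measurable g →
      ∫ z, ‖H z * φ (g z)‖ ≤ M * ∫ z, ‖H z‖ := fun {H} hH g hg => by
    rw [← integral_const_mul]
    refine integral_mono (ib hH hg).norm (hH.norm.const_mul M) fun z => ?_
    simp only [norm_mul]
    rw [mul_comm]
    exact mul_le_mul_of_nonneg_right (hφ.abs_le _) (norm_nonneg _)
  have m1 : ∀ h : Rn N, Measurable fun z : Rn N × Rn N => z.1 - h := fun h => by fun_prop
  have m2 : ∀ h : Rn N, Measurable fun z : Rn N × Rn N => z.2 - h := fun h => by fun_prop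
  have hball : ∀ᶠ h in 𝓝 (0 : Rn N), ‖h‖ < (R - r) / 2 := by
    filter_upwards [ball_mem_nhds (0 : Rn N) (by linarith : 0 < (R - r) / 2)] with h hh
    simpa using hh
  have hnorm := (tendsto_integral_translate_mul (volume : Measure (Rn N × Rn N))
    ENNReal.ofReal_ne_top hΦ.norm hH₁.norm).comp hc
  refine ⟨(∫ z, ‖Φ z‖ * ‖H₁ z‖) + 1 + (M * ∫ z, ‖H₂ z‖) + M * ∫ z, ‖H₃ z‖, ?_, ?_⟩
  · filter_upwards [hball, hnorm.eventually (eventually_le_nhds (lt_add_one _))] with h hh hle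
    have hint := ((i1 h).add (ib hH₂ (m1 h))).sub (ib hH₃ (m2 h))
    refine ⟨hint.congr (.of_forall fun z => (heq h hh z).symm), ?_⟩
    simp only [Function.comp_apply] at hle
    calc ∫ z, ‖F z * (φ (z.1 - h) - φ (z.2 - h))‖
        ≤ ∫ z, (‖Φ (z - (h, h)) * H₁ z‖ + ‖H₂ z * φ (z.1 - h)‖ + ‖H₃ z * φ (z.2 - h)‖) := by
          refine integral_mono (hint.congr (.of_forall fun z => (heq h hh z).symm)).norm
            (((i1 h).norm.add (ib hH₂ (m1 h)).norm).add (ib hH₃ (m2 h)).norm) fun z => ?_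
          simp only
          rw [heq h hh z]
          exact (norm_sub_le _ _).trans (add_le_add_left (norm_add_le _ _) _)
      _ = (∫ z, ‖Φ (z - (h, h)) * H₁ z‖) + (∫ z, ‖H₂ z * φ (z.1 - h)‖) +
            ∫ z, ‖H₃ z * φ (z.2 - h)‖ := by
          rw [integral_add (f := fun z => ‖Φ (z - (h, h)) * H₁ z‖ + ‖H₂ z * φ (z.1 - h)‖)
            ((i1 h).norm.add (ib hH₂ (m1 h)).norm) (ib hH₃ (m2 h)).norm,
            integral_add (i1 h).norm (ib hH₂ (m1 h)).norm]
      _ ≤ _ := by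
          simp only [norm_mul (Φ _)]
          exact add_le_add (add_le_add hle (bb hH₂ (m1 h))) (bb hH₃ (m2 h))
  · have t1 := (tendsto_integral_translate_mul (volume : Measure (Rn N × Rn N))
      ENNReal.ofReal_ne_top hΦ hH₁).comp hc
    have t2 := tendsto_integral_mul_translate_of_bounded hφ hH₂ (.fst ℝ _ _) (.inl ℝ _ _)
      (fun x => rfl)
    have t3 := tendsto_integral_mul_translate_of_bounded hφ hH₃ (.snd ℝ _ _) (.inr ℝ _ _)
      (fun x => rfl)
    have hG : ∀ h : Rn N, ‖h‖ < (R - r) / 2 → ∫ z, F z * (φ (z.1 - h) - φ (z.2 - h)) =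
        (∫ z, Φ (z - (h, h)) * H₁ z) + (∫ z, H₂ z * φ (z.1 - h)) - ∫ z, H₃ z * φ (z.2 - h) := by
      intro h hh
      rw [← integral_add (i1 h) (ib hH₂ (m1 h)),
        ← integral_sub (f := fun z => Φ (z - (h, h)) * H₁ z + H₂ z * φ (z.1 - h)) ((i1 h).add (ib hH₂ (m1 h))) (ib hH₃ (m2 h))]
      exact integral_congr_ae (.of_forall fun z => heq h hh z)
    have hG0 := hG 0 (by simpa using hr)
    have z0 : ∀ z : Rn N × Rn N, z - (0, 0) = z := fun z => sub_zero z
    simp only [sub_zero, z0] at hG0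
    rw [hG0]
    refine ((t1.add t2).sub t3).congr' ?_
    filter_upwards [hball] with h hh
    exact (hG h hh).symm

/-- A supersolution may be tested with rough test functions. -/
theorem IsRoughTestFunction.integral_flux_nonneg (hp : 1 < p) (hΛ : 0 < Λ₁)
    (hd : (N : ℝ) < (N : ℝ) + p * s) (hK : IsKernel p s Λ₁ Λ₂ K)
    (hv : HasFiniteEnergy p ((N : ℝ) + p * s) v x₀ R) (hr : r < R)
    (hφ : IsRoughTestFunction p ((N : ℝ) + p * s) M φ x₀ r R) {Ω : Set (Rn N)}
    (hΩ : ball x₀ R ⊆ Ω) (hw : ∀ ψ, IsTestFunction Ω ψ → 0 ≤ weakForm p K v ψ) :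
    Integrable (fun z => flux p K v z * (φ z.1 - φ z.2)) ∧
      0 ≤ ∫ z, flux p K v z * (φ z.1 - φ z.2) := by
  obtain ⟨C, hC, hlim⟩ := hφ.eventually_translate hp hΛ hd hK hv hr
  have hF := aestronglyMeasurable_flux hv.measurable hK
  set F := flux p K v
  set G : Rn N → ℝ := fun h => ∫ z, F z * (φ (z.1 - h) - φ (z.2 - h)) with hGdef
  set G₀ := ∫ z, F z * (φ z.1 - φ z.2)
  refine ⟨by simpa using hC.self_of_nhds.1, ?_⟩
  -- If the weak form at `φ` were negative, it would stay below `G₀ / 2 < 0` for small translates.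
  -- Its average against a mollifier of small support would be negative too, yet that average is the
  -- weak form of an admissible function.
  by_contra! hneg
  have hev : ∀ᶠ h in 𝓝 (0 : Rn N), G h < G₀ / 2 := hlim.eventually (gt_mem_nhds (by linarith))
  obtain ⟨ε₀, hε₀, hball⟩ := Metric.eventually_nhds_iff_ball.1 (hC.and hev)
  set ε := min ε₀ ((R - r) / 2) with hε
  have hεpos : 0 < ε := lt_min hε₀ (by linarith)
  have hεr : r + ε < R := by have := min_le_right ε₀ ((R - r) / 2); linarith
  let b : ContDiffBump (0 : Rn N) := ⟨ε / 2, ε, by linarith, by linarith⟩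
  set ρ := b.normed volume with hρ
  have hρ0 : ∀ t, 0 ≤ ρ t := fun t => b.nonneg_normed t
  have hρsupp : ∀ t, t ∉ ball (0 : Rn N) ε → ρ t = 0 := fun t ht => by
    have := b.support_normed_eq (μ := (volume : Measure (Rn N)))
    by_contra h
    exact ht (this ▸ Function.mem_support.2 h)
  have hρc : HasCompactSupport ρ := b.hasCompactSupport_normed
  have hρcont : Continuous ρ := b.continuous_normed
  have hρint : Integrable ρ := b.integrable_normed
  have hφloc : LocallyIntegrable φ :=
    (hφ.memLp_top_comp (μ := volume) measurable_id).locallyIntegrable le_top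
  set ψ : Rn N → ℝ := convolution ρ φ (ContinuousLinearMap.lsmul ℝ ℝ) volume with hψ
  have hψint : ∀ x, Integrable (fun t => ρ t * φ (x - t)) := fun x =>
    (hρc.convolutionExists_left (ContinuousLinearMap.lsmul ℝ ℝ) hρcont hφloc) x
  have hψeq : ∀ x, ψ x = ∫ t, ρ t * φ (x - t) := fun x => rfl
  have htsupp : tsupport ψ ⊆ closedBall x₀ (r + ε) := by
    refine closure_minimal (fun x hx => ?_) isClosed_closedBall
    by_contra hx'
    refine hx ?_
    rw [hψeq]
    refine integral_eq_zero_of_ae (.of_forall fun t => ?_)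
    simp only [Pi.zero_apply, mul_eq_zero]
    by_cases ht : t ∈ ball (0 : Rn N) ε
    · refine Or.inr (hφ.eq_zero _ fun hxt => hx' ?_)
      rw [mem_ball, dist_eq_norm] at hxt ht
      rw [mem_closedBall, dist_eq_norm]
      have : x - x₀ = (x - t - x₀) + (t - 0) := by abel
      rw [this]
      linarith [norm_add_le (x - t - x₀) (t - 0)]
    · exact Or.inl (hρsupp t ht)
  have htest : IsTestFunction Ω ψ :=
    { contDiff := by
        have := hρc.contDiff_convolution_left (ContinuousLinearMap.lsmul ℝ ℝ) (n := 1)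
          (b.contDiff_normed) hφloc
        exact_mod_cast this
      hasCompactSupport := HasCompactSupport.of_support_subset_isCompact
        (isCompact_closedBall x₀ (r + ε)) ((subset_tsupport ψ).trans htsupp)
      tsupport_subset := htsupp.trans ((closedBall_subset_ball hεr).trans hΩ)
      nonneg := fun x => by
        rw [hψeq]
        exact integral_nonneg fun t => mul_nonneg (hρ0 t) (hφ.nonneg _) }
  have hpos := hw ψ htest
  rw [weakForm_eq_integral_flux] at hpos
  have hm := hφ.measurable
  let J : Rn N → Rn N × Rn N → ℝ := fun t z => ρ t * (F z * (φ (z.1 - t) - φ (z.2 - t)))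
  have hJm : AEStronglyMeasurable (Function.uncurry J)
      ((volume : Measure (Rn N)).prod (volume : Measure (Rn N × Rn N))) := by
    refine AEStronglyMeasurable.mul (hρcont.comp continuous_fst).aestronglyMeasurable
      (AEStronglyMeasurable.mul hF.comp_snd ?_)
    exact (by fun_prop : Measurable fun a : Rn N × Rn N × Rn N =>
      φ (a.2.1 - a.1) - φ (a.2.2 - a.1)).aestronglyMeasurable
  have hJint : Integrable (Function.uncurry J)
      ((volume : Measure (Rn N)).prod (volume : Measure (Rn N × Rn N))) := by
    rw [integrable_prod_iff hJm]
    constructor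
    · refine .of_forall fun t => ?_
      by_cases ht : t ∈ ball (0 : Rn N) ε
      · exact (hball t (ball_subset_ball (min_le_left _ _) ht)).1.1.const_mul (ρ t)
      · simp [J, hρsupp t ht]
    · refine Integrable.mono' (hρint.mul_const C) hJm.norm.integral_prod_right' ?_
      refine .of_forall fun t => ?_
      rw [Real.norm_of_nonneg (integral_nonneg fun _ => norm_nonneg _)]
      by_cases ht : t ∈ ball (0 : Rn N) ε
      · simp only [Function.uncurry_apply_pair, J]
        simp only [norm_mul (ρ t)]
        rw [integral_const_mul, Real.norm_of_nonneg (hρ0 t)]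
        exact mul_le_mul_of_nonneg_left
          (hball t (ball_subset_ball (min_le_left _ _) ht)).1.2 (hρ0 t)
      · simp [J, hρsupp t ht]
  -- Mollification commutes with the weak form, which is linear in the test function.
  have hfub : ∫ z, F z * (ψ z.1 - ψ z.2) = ∫ t, ρ t * G t := by
    calc ∫ z, F z * (ψ z.1 - ψ z.2) = ∫ z, ∫ t, J t z := by
          refine integral_congr_ae (.of_forall fun z => ?_)
          simp only [hψeq, J]
          rw [← integral_sub (hψint _) (hψint _), ← integral_const_mul]
          congr 1
          ext t
          ring
      _ = ∫ t, ∫ z, J t z := (integral_integral_swap hJint).symm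
      _ = ∫ t, ρ t * G t := by
          simp only [J, hGdef, integral_const_mul]
  have hlt : ∫ t, ρ t * G t ≤ ∫ t, ρ t * (G₀ / 2) := by
    refine integral_mono ?_ (hρint.mul_const _) fun t => ?_
    · have := hJint.integral_prod_left
      simpa only [Function.uncurry_apply_pair, J, integral_const_mul] using this
    · by_cases ht : t ∈ ball (0 : Rn N) ε
      · exact mul_le_mul_of_nonneg_left
          (hball t (ball_subset_ball (min_le_left _ _) ht)).2.le (hρ0 t)
      · simp [hρsupp t ht]
  rw [integral_mul_const, b.integral_normed, one_mul] at hlt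
  linarith

end TestFunctionExtension

/-! ### The truncated test function has finite energy. -/

section Cutoff

variable {N : ℕ} {p d l k : ℝ} {v : Rn N → ℝ} {x₀ : Rn N} {r r' R : ℝ}

/-- The Lipschitz cutoff between `ball x₀ r'` and `ball x₀ r`. -/
def cutoff (x₀ : Rn N) (r' r : ℝ) (x : Rn N) : ℝ := max 0 (min 1 ((r - ‖x - x₀‖) / (r - r')))

theorem cutoff_mem_Icc (x : Rn N) : cutoff x₀ r' r x ∈ Icc (0 : ℝ) 1 :=
  ⟨le_max_left _ _, max_le zero_le_one (min_le_left _ _)⟩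

theorem cutoff_eq_one (h : r' < r) {x : Rn N} (hx : x ∈ ball x₀ r') : cutoff x₀ r' r x = 1 := by
  rw [mem_ball, dist_eq_norm] at hx
  have : 1 ≤ (r - ‖x - x₀‖) / (r - r') := by
    rw [one_le_div (by linarith)]; linarith
  rw [cutoff, min_eq_left this, max_eq_right zero_le_one]

theorem cutoff_eq_zero (h : r' < r) {x : Rn N} (hx : x ∉ ball x₀ r) : cutoff x₀ r' r x = 0 := by
  rw [mem_ball, dist_eq_norm, not_lt] at hx
  have : (r - ‖x - x₀‖) / (r - r') ≤ 0 := div_nonpos_of_nonpos_of_nonneg (by linarith) (by linarith)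
  rw [cutoff, max_eq_left ((min_le_right _ _).trans this)]

theorem abs_cutoff_sub_le (h : r' < r) (x y : Rn N) :
    |cutoff x₀ r' r x - cutoff x₀ r' r y| ≤ ‖x - y‖ / (r - r') := by
  have h0 : 0 < r - r' := by linarith
  unfold cutoff
  refine (abs_max_sub_max_le_max _ _ _ _).trans ?_
  rw [sub_self, abs_zero]
  refine max_le (by positivity) ((abs_min_sub_min_le_max _ _ _ _).trans ?_)
  rw [sub_self, abs_zero]
  refine max_le (by positivity) ?_
  rw [← sub_div, abs_div, abs_of_pos h0]
  gcongr
  have := abs_norm_sub_norm_le (y - x₀) (x - x₀)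
  rw [sub_sub_sub_cancel_right, norm_sub_rev y x] at this
  simpa using this

theorem measurable_cutoff : Measurable (cutoff x₀ r' r) := by
  unfold cutoff; fun_prop

/-- The truncation of `v` at the level `l` from below, times a power of a cutoff. -/
def truncTest (p l : ℝ) (x₀ : Rn N) (r' r : ℝ) (v : Rn N → ℝ) (x : Rn N) : ℝ :=
  max (l - v x) 0 * cutoff x₀ r' r x ^ p

theorem truncTest_of_le {x : Rn N} (hx : v x ≤ l) :
    truncTest p l x₀ r' r v x = (l - v x) * cutoff x₀ r' r x ^ p := by
  rw [truncTest, max_eq_left (by linarith)]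

theorem truncTest_of_ge {x : Rn N} (hx : l ≤ v x) : truncTest p l x₀ r' r v x = 0 := by
  rw [truncTest, max_eq_right (by linarith), zero_mul]

theorem truncTest_eq_zero (hp : 0 < p) (h : r' < r) {x : Rn N} (hx : x ∉ ball x₀ r) :
    truncTest p l x₀ r' r v x = 0 := by
  rw [truncTest, cutoff_eq_zero h hx, Real.zero_rpow hp.ne', mul_zero]

theorem truncTest_nonneg (x : Rn N) : 0 ≤ truncTest p l x₀ r' r v x :=
  mul_nonneg (le_max_right _ _) (Real.rpow_nonneg (cutoff_mem_Icc x).1 _)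

theorem truncTest_le (hp : 0 < p) (h : r' < r) (hr : r ≤ R) (hl : 0 ≤ l)
    (hv0 : ∀ x ∈ ball x₀ R, 0 ≤ v x) (x : Rn N) : truncTest p l x₀ r' r v x ≤ l := by
  by_cases hx : x ∈ ball x₀ r
  · have h1 : max (l - v x) 0 ≤ l := max_le (by linarith [hv0 x (ball_subset_ball hr hx)]) hl
    have h2 : cutoff x₀ r' r x ^ p ≤ 1 :=
      Real.rpow_le_one (cutoff_mem_Icc x).1 (cutoff_mem_Icc x).2 hp.le
    calc truncTest p l x₀ r' r v x ≤ l * 1 :=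
          mul_le_mul h1 h2 (Real.rpow_nonneg (cutoff_mem_Icc x).1 _) hl
      _ = l := mul_one l
  · rw [truncTest_eq_zero hp h hx]; exact hl

/-- The Lipschitz bound on the cutoff improves the kernel exponent to `p - d > -N`, which is
integrable at the diagonal. For `x ∈ A`, the set `A` lies in the ball of radius `2r` about `x`. -/
theorem exists_lintegral_prod_norm_rpow_le (hN : 1 ≤ N) (hp : 0 < p) (hd : d < N + p) :
    ∃ C : ℝ, 0 < C ∧ ∀ (x₀ : Rn N) (r : ℝ), 0 < r → ∀ A ⊆ ball x₀ r,
      ∫⁻ z in A ×ˢ A, ENNReal.ofReal (‖z.1 - z.2‖ ^ p / ‖z.1 - z.2‖ ^ d) ≤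
        ENNReal.ofReal (C * (2 * r) ^ ((N : ℝ) + (p - d))) * volume A := by
  obtain ⟨C, hC0, hC⟩ := exists_setLIntegral_ball_norm_rpow_le hN (a := p - d) (by linarith)
  refine ⟨C, hC0, fun x₀ r hr A hA => ?_⟩
  rw [Measure.volume_eq_prod, setLIntegral_prod _ (by fun_prop)]
  rw [← setLIntegral_const]
  refine setLIntegral_mono (by fun_prop) fun x hx => ?_
  refine le_trans ?_ (hC x (2 * r) (by linarith))
  refine (lintegral_mono fun y => ENNReal.ofReal_le_ofReal ?_).trans
    (lintegral_mono_set fun y hy => ?_)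
  · rcases (norm_nonneg (x - y)).eq_or_lt with h0 | h0
    · simp only [← h0, Real.zero_rpow hp.ne', zero_div]
      exact Real.zero_rpow_nonneg _
    · simp only [Real.rpow_sub h0, le_refl]
  · have h1 := mem_ball.1 (hA hx)
    have h2 := mem_ball.1 (hA hy)
    rw [mem_ball]
    linarith [dist_triangle_right y x x₀]

theorem isRoughTestFunction_truncTest (hN : 1 ≤ N) (hp : 1 < p) (hd : d < N + p) (h : r' < r)
    (hr : r ≤ R) (hR : 0 < R) (hl : 0 ≤ l) (hv : HasFiniteEnergy p d v x₀ R)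
    (hv0 : ∀ x ∈ ball x₀ R, 0 ≤ v x) :
    IsRoughTestFunction p d l (truncTest p l x₀ r' r v) x₀ r R := by
  have hp0 : 0 < p := by linarith
  have hvm := hv.measurable
  have hηm := measurable_cutoff (x₀ := x₀) (r' := r') (r := r)
  set L := 1 / (r - r') with hL
  have hL0 : 0 < L := by rw [hL]; exact one_div_pos.2 (by linarith)
  refine ⟨?_, truncTest_nonneg, truncTest_le hp0 h hr hl hv0,
    fun x hx => truncTest_eq_zero hp0 h hx, ?_⟩
  · unfold truncTest; fun_prop
  obtain ⟨C, -, hC⟩ := exists_lintegral_prod_norm_rpow_le hN hp0 hd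
  have hfin := (hC x₀ R hR _ Subset.rfl).trans_lt
    (ENNReal.mul_lt_top ENNReal.ofReal_lt_top measure_ball_lt_top)
  -- Product rule for differences: truncation is 1-Lipschitz in `v` and bounded by `l`, while the
  -- power of the cutoff is bounded by `1` and Lipschitz.
  have hpt : ∀ x ∈ ball x₀ R, ∀ y ∈ ball x₀ R,
      |truncTest p l x₀ r' r v x - truncTest p l x₀ r' r v y| ≤
        |v x - v y| + l * (p * L) * ‖x - y‖ := by
    intro x hx y hy
    set η := cutoff x₀ r' r
    have hw : |max (l - v x) 0 - max (l - v y) 0| ≤ |v x - v y| := by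
      refine (abs_max_sub_max_le_abs _ _ _).trans ?_
      rw [sub_sub_sub_cancel_left, abs_sub_comm]
    have hη1 : η x ^ p ≤ 1 :=
      Real.rpow_le_one (cutoff_mem_Icc x).1 (cutoff_mem_Icc x).2 hp0.le
    have hη0 : 0 ≤ η x ^ p := Real.rpow_nonneg (cutoff_mem_Icc x).1 _
    have hwy : |max (l - v y) 0| ≤ l := by
      rw [abs_of_nonneg (le_max_right _ _)]
      exact max_le (by linarith [hv0 y hy]) hl
    have hηη : |η x ^ p - η y ^ p| ≤ p * L * ‖x - y‖ := by
      refine (abs_rpow_sub_rpow_le hp.le (cutoff_mem_Icc x) (cutoff_mem_Icc y)).trans ?_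
      rw [mul_assoc]
      gcongr
      refine (abs_cutoff_sub_le h x y).trans (le_of_eq ?_)
      rw [hL]; ring
    have e : truncTest p l x₀ r' r v x - truncTest p l x₀ r' r v y =
        (max (l - v x) 0 - max (l - v y) 0) * η x ^ p + max (l - v y) 0 * (η x ^ p - η y ^ p) := by
      simp only [truncTest, η]; ring
    rw [e]
    refine (abs_add_le _ _).trans (add_le_add ?_ ?_)
    · rw [abs_mul, abs_of_nonneg hη0]
      calc _ ≤ |v x - v y| * 1 := mul_le_mul hw hη1 hη0 (abs_nonneg _)
        _ = _ := mul_one _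
    · rw [abs_mul, mul_assoc l]
      gcongr
  calc ∫⁻ z in ball x₀ R ×ˢ ball x₀ R,
        ENNReal.ofReal (|truncTest p l x₀ r' r v z.1 - truncTest p l x₀ r' r v z.2| ^ p /
          ‖z.1 - z.2‖ ^ d)
      ≤ ∫⁻ z in ball x₀ R ×ˢ ball x₀ R,
        (ENNReal.ofReal (2 ^ p) * ENNReal.ofReal (|v z.1 - v z.2| ^ p / ‖z.1 - z.2‖ ^ d) +
          ENNReal.ofReal (2 ^ p * (l * (p * L)) ^ p) *
            ENNReal.ofReal (‖z.1 - z.2‖ ^ p / ‖z.1 - z.2‖ ^ d)) := by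
        refine setLIntegral_mono (by fun_prop) fun z hz => ?_
        rw [← ENNReal.ofReal_mul (by positivity), ← ENNReal.ofReal_mul (by positivity),
          ← ENNReal.ofReal_add (by positivity) (by positivity)]
        refine ENNReal.ofReal_le_ofReal ?_
        have h1 : |truncTest p l x₀ r' r v z.1 - truncTest p l x₀ r' r v z.2| ^ p ≤
            2 ^ p * (|v z.1 - v z.2| ^ p + (l * (p * L) * ‖z.1 - z.2‖) ^ p) :=
          (Real.rpow_le_rpow (abs_nonneg _) (hpt _ hz.1 _ hz.2) hp0.le).trans
            (add_rpow_le_two_rpow_mul hp0.le (abs_nonneg _) (by positivity))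
        rw [Real.mul_rpow (by positivity) (norm_nonneg _)] at h1
        calc _ ≤ (2 ^ p * (|v z.1 - v z.2| ^ p + (l * (p * L)) ^ p * ‖z.1 - z.2‖ ^ p)) /
              ‖z.1 - z.2‖ ^ d := by gcongr
          _ = _ := by ring
    _ < ∞ := by
        rw [lintegral_add_left (by fun_prop), lintegral_const_mul _ (by fun_prop),
          lintegral_const_mul _ (by fun_prop)]
        exact ENNReal.add_lt_top.2 ⟨ENNReal.mul_lt_top ENNReal.ofReal_lt_top hv.inner,
          ENNReal.mul_lt_top ENNReal.ofReal_lt_top hfin⟩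

end Cutoff

/-! ### The tail contribution. -/

section Tail

variable {N : ℕ}

theorem measurable_negPart_comp {v : Rn N → ℝ} (hv : Measurable v) :
    Measurable fun y => (v y)⁻ := by
  simp only [negPart_def]
  exact hv.neg.sup_const 0

theorem exists_lintegral_tail_le {p s T : ℝ} (hp : 1 < p) (hs : 0 < s) (hT : 0 ≤ T) :
    ∃ C : ℝ, 0 < C ∧ ∀ (v : Rn N → ℝ) (x₀ : Rn N) (ρ k : ℝ), Measurable v → 0 < ρ → 0 < k →
      (∀ x ∈ ball x₀ ρ, 0 ≤ v x) →
      ∫⁻ y in (ball x₀ ρ)ᶜ, ENNReal.ofReal ((v y)⁻ ^ (p - 1) / ‖y - x₀‖ ^ ((N : ℝ) + p * s)) ≤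
        ENNReal.ofReal (T * k ^ (p - 1) * ρ ^ (-(p * s))) →
      ∀ r' r : ℝ, r' < r → ρ / 2 ≤ r → r ≤ ρ → ∀ A ⊆ ball x₀ r',
        ∫⁻ z in A ×ˢ (ball x₀ r)ᶜ,
          ENNReal.ofReal ((k + (v z.2)⁻) ^ (p - 1) * k / ‖z.1 - z.2‖ ^ ((N : ℝ) + p * s)) ≤
        ENNReal.ofReal (C * (ρ / (r - r')) ^ ((N : ℝ) + p * s) * k ^ p * ρ ^ (-(p * s))) *
          volume A := by
  set d := (N : ℝ) + p * s with hd
  have hps : 0 < p * s := by positivity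
  have hd0 : 0 < d := by positivity
  obtain ⟨C, hC0, hC⟩ := exists_setLIntegral_compl_ball_norm_rpow_le (N := N) (a := -d)
    (by rw [hd]; linarith)
  refine ⟨2 ^ (p - 1) * (C * 2 ^ (p * s) + T), by positivity, ?_⟩
  intro v x₀ ρ k hv hρ hk hv0 htail r' r hr' hr hrρ A hA
  have hr0 : 0 < r := by linarith
  have hη : 0 < r - r' := by linarith
  have hout : ∫⁻ y in (ball x₀ r)ᶜ,
      ENNReal.ofReal ((k + (v y)⁻) ^ (p - 1) / ‖y - x₀‖ ^ d) ≤
      ENNReal.ofReal (2 ^ (p - 1) * (C * 2 ^ (p * s) + T) * (k ^ (p - 1) * ρ ^ (-(p * s)))) := by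
    have hneg : ∀ y, 0 ≤ (v y)⁻ := fun y => negPart_nonneg _
    have hm := measurable_negPart_comp hv
    calc ∫⁻ y in (ball x₀ r)ᶜ, ENNReal.ofReal ((k + (v y)⁻) ^ (p - 1) / ‖y - x₀‖ ^ d)
        ≤ ∫⁻ y in (ball x₀ r)ᶜ, ENNReal.ofReal (2 ^ (p - 1)) *
            (ENNReal.ofReal (k ^ (p - 1)) * ENNReal.ofReal (‖x₀ - y‖ ^ (-d)) +
              ENNReal.ofReal ((v y)⁻ ^ (p - 1) / ‖y - x₀‖ ^ d)) := by
          refine lintegral_mono fun y => ?_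
          rw [← ENNReal.ofReal_mul (by positivity), ← ENNReal.ofReal_add (by positivity)
            (div_nonneg (Real.rpow_nonneg (hneg y) _) (by positivity)),
            ← ENNReal.ofReal_mul (by positivity)]
          refine ENNReal.ofReal_le_ofReal ?_
          calc (k + (v y)⁻) ^ (p - 1) / ‖y - x₀‖ ^ d
              ≤ (2 ^ (p - 1) * (k ^ (p - 1) + (v y)⁻ ^ (p - 1))) / ‖y - x₀‖ ^ d := by
                gcongr
                exact add_rpow_le_two_rpow_mul (by linarith) hk.le (hneg y)
            _ = _ := by
                rw [Real.rpow_neg (norm_nonneg _), norm_sub_rev x₀ y]; ring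
      _ = ENNReal.ofReal (2 ^ (p - 1)) *
            (ENNReal.ofReal (k ^ (p - 1)) *
              (∫⁻ y in (ball x₀ r)ᶜ, ENNReal.ofReal (‖x₀ - y‖ ^ (-d))) +
              ∫⁻ y in (ball x₀ r)ᶜ, ENNReal.ofReal ((v y)⁻ ^ (p - 1) / ‖y - x₀‖ ^ d)) := by
          rw [lintegral_const_mul _ (by fun_prop), lintegral_add_left (by fun_prop),
            lintegral_const_mul _ (by fun_prop)]
      _ ≤ ENNReal.ofReal (2 ^ (p - 1)) *
            (ENNReal.ofReal (k ^ (p - 1)) * ENNReal.ofReal (C * (ρ / 2) ^ (-(p * s))) +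
              ENNReal.ofReal (T * k ^ (p - 1) * ρ ^ (-(p * s)))) := by
          gcongr
          · refine (lintegral_mono_set ?_).trans ((hC x₀ (ρ / 2) (by positivity)).trans ?_)
            · exact compl_subset_compl.2 (ball_subset_ball hr)
            · rw [hd]; simp
          -- The negative part vanishes in `B_ρ`, so enlarging the domain from the complement of
          -- `B_ρ` to that of `B_r` costs nothing.
          · refine le_trans ?_ htail
            rw [← lintegral_indicator measurableSet_ball.compl,
              ← lintegral_indicator measurableSet_ball.compl]
            refine lintegral_mono fun y => ?_
            classical
            simp only [indicator_apply, mem_compl_iff]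
            by_cases hy : y ∈ ball x₀ ρ
            · have : (v y)⁻ = 0 := negPart_eq_zero.2 (hv0 y hy)
              simp [this, Real.zero_rpow (by linarith : p - 1 ≠ 0)]
            · have : y ∉ ball x₀ r := fun h => hy (ball_subset_ball hrρ h)
              simp only [hy, this, not_false_eq_true, if_true, le_refl]
      _ = _ := by
          rw [← ENNReal.ofReal_mul (by positivity), ← ENNReal.ofReal_add (by positivity)
            (by positivity), ← ENNReal.ofReal_mul (by positivity)]
          congr 1
          rw [Real.div_rpow hρ.le (by norm_num), Real.rpow_neg (by norm_num : (0 : ℝ) ≤ 2)]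
          field_simp
  have hmeas : Measurable fun z : Rn N × Rn N =>
      ENNReal.ofReal ((k + (v z.2)⁻) ^ (p - 1) * k / ‖z.1 - z.2‖ ^ d) := by
    have hm := measurable_negPart_comp hv
    fun_prop
  rw [Measure.volume_eq_prod, setLIntegral_prod _ hmeas.aemeasurable, ← setLIntegral_const]
  refine setLIntegral_mono (by fun_prop) fun x hx => ?_
  have hxr : ‖x - x₀‖ < r' := by
    have := hA hx
    rwa [mem_ball, dist_eq_norm] at this
  calc ∫⁻ y in (ball x₀ r)ᶜ, ENNReal.ofReal ((k + (v y)⁻) ^ (p - 1) * k / ‖x - y‖ ^ d)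
      ≤ ∫⁻ y in (ball x₀ r)ᶜ, ENNReal.ofReal (k * (ρ / (r - r')) ^ d) *
          ENNReal.ofReal ((k + (v y)⁻) ^ (p - 1) / ‖y - x₀‖ ^ d) := by
        have hm := measurable_negPart_comp hv
        refine setLIntegral_mono (by fun_prop) fun y hy => ?_
        rw [mem_compl_iff, mem_ball, dist_eq_norm, not_lt] at hy
        rw [← ENNReal.ofReal_mul (by positivity)]
        refine ENNReal.ofReal_le_ofReal ?_
        have hn : 0 ≤ (v y)⁻ := negPart_nonneg _
        have hy0 : 0 < ‖y - x₀‖ := hr0.trans_le hy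
        -- The ratio `(τ - r') / τ` increases with `τ = ‖y - x₀‖ ≥ r`, so `‖x - y‖ ≥ τ (r - r') /
        -- r`. This trades the pole `x` for `x₀` at the price `(ρ / (r - r'))^d`.
        have hxy : ‖y - x₀‖ * ((r - r') / ρ) ≤ ‖x - y‖ := by
          have h1 : ‖y - x₀‖ ≤ ‖x - y‖ + ‖x - x₀‖ := by
            have : y - x₀ = -(x - y) + (x - x₀) := by abel
            rw [this]
            exact (norm_add_le _ _).trans (by rw [norm_neg])
          rw [mul_div_assoc', div_le_iff₀ hρ]
          have h2 : ‖x - y‖ ≥ ‖y - x₀‖ - r' := by linarith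
          have h3 : 0 ≤ ‖x - y‖ := norm_nonneg _
          have h4 : (‖y - x₀‖ - r') * r ≤ ‖x - y‖ * ρ := by
            nlinarith
          have h5 : 0 < r' := (norm_nonneg _).trans_lt hxr
          nlinarith
        have hpos : 0 < ‖y - x₀‖ * ((r - r') / ρ) := by positivity
        calc (k + (v y)⁻) ^ (p - 1) * k / ‖x - y‖ ^ d
            ≤ (k + (v y)⁻) ^ (p - 1) * k / (‖y - x₀‖ * ((r - r') / ρ)) ^ d := by gcongr
          _ = _ := by
              rw [Real.mul_rpow hy0.le (by positivity), Real.div_rpow hη.le hρ.le,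
                Real.div_rpow hρ.le hη.le]
              field_simp
    _ = ENNReal.ofReal (k * (ρ / (r - r')) ^ d) *
          ∫⁻ y in (ball x₀ r)ᶜ, ENNReal.ofReal ((k + (v y)⁻) ^ (p - 1) / ‖y - x₀‖ ^ d) := by
        have hm := measurable_negPart_comp hv
        rw [lintegral_const_mul _ (by fun_prop)]
    _ ≤ _ := by
        refine (mul_le_mul_right hout _).trans (le_of_eq ?_)
        rw [← ENNReal.ofReal_mul (by positivity)]
        congr 1
        have : k ^ p = k * k ^ (p - 1) := by
          rw [mul_comm, ← Real.rpow_add_one hk.ne']; simp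
        rw [this]; ring

end Tail

/-! ### The energy estimate for sublevel sets. -/

section EnergyEstimate

variable {N : ℕ} {p d l l' k : ℝ} {v : Rn N → ℝ} {x₀ : Rn N} {r r' rm : ℝ}

theorem oddPow_mul_truncTest_swap (x y : Rn N) :
    oddPow p (v x - v y) * (truncTest p l x₀ r' rm v x - truncTest p l x₀ r' rm v y) =
      oddPow p (v y - v x) * (truncTest p l x₀ r' rm v y - truncTest p l x₀ r' rm v x) := by
  rw [← neg_sub (v y) (v x), oddPow_neg]; ring

theorem oddPow_mul_truncTest_le_of_both (hp : 1 < p) (h : r' < rm) {x y : Rn N} (hx : v x < l)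
    (hy : v y < l) (hx0 : 0 ≤ v x) (hy0 : 0 ≤ v y) :
    oddPow p (v x - v y) * (truncTest p l x₀ r' rm v x - truncTest p l x₀ r' rm v y) ≤
      (p * l / (rm - r')) ^ p * ‖x - y‖ ^ p := by
  have h0 : 0 < rm - r' := by linarith
  have hl : 0 ≤ l := hx0.trans hx.le
  rw [truncTest_of_le hx.le, truncTest_of_le hy.le]
  refine (oddPow_mul_le_of_lt_of_lt hp hx.le hy.le (M := l) (by linarith) (by linarith)
    (cutoff_mem_Icc x).1 (cutoff_mem_Icc y).1).trans ?_
  rw [← Real.mul_rpow (by positivity) (norm_nonneg _)]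
  refine Real.rpow_le_rpow (by positivity) ?_ (by linarith)
  calc p * l * |cutoff x₀ r' rm x - cutoff x₀ r' rm y| ≤ p * l * (‖x - y‖ / (rm - r')) := by
        gcongr; exact abs_cutoff_sub_le h x y
    _ = _ := by ring

theorem oddPow_mul_truncTest_le_neg (hp : 1 < p) {x y : Rn N} (hx : v x ≤ l) (hy : l ≤ v y) :
    oddPow p (v x - v y) * (truncTest p l x₀ r' rm v x - truncTest p l x₀ r' rm v y) ≤
      -((l - v x) ^ p * cutoff x₀ r' rm x ^ p) := by
  rw [truncTest_of_le hx, truncTest_of_ge hy, sub_zero]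
  exact oddPow_mul_le_neg hp hx hy (Real.rpow_nonneg (cutoff_mem_Icc x).1 _)

/-- The sublevel set of `v` in a ball. -/
def sublevelBall (v : Rn N → ℝ) (l : ℝ) (x₀ : Rn N) (r : ℝ) : Set (Rn N) :=
  {x ∈ ball x₀ r | v x < l}

theorem measurableSet_sublevelBall (hv : Measurable v) : MeasurableSet (sublevelBall v l x₀ r) :=
  measurableSet_ball.inter (measurableSet_lt hv measurable_const)

theorem sublevelBall_subset : sublevelBall v l x₀ r ⊆ ball x₀ r := fun _ hx => hx.1

theorem sublevelBall_mono (hl : l' ≤ l) (hr : r' ≤ r) :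
    sublevelBall v l' x₀ r' ⊆ sublevelBall v l x₀ r := fun _ hx =>
  ⟨ball_subset_ball hr hx.1, hx.2.trans_le hl⟩

theorem oddPow_mul_truncTest_le_of_notMem (hp : 1 < p) (h : r' < rm) (hr : rm ≤ r) (hlk : l ≤ k)
    (hv0 : ∀ x ∈ ball x₀ r, 0 ≤ v x) {x y : Rn N} (hx : x ∈ ball x₀ r) (hy : y ∉ ball x₀ r) :
    oddPow p (v x - v y) * (truncTest p l x₀ r' rm v x - truncTest p l x₀ r' rm v y) ≤
      (sublevelBall v l x₀ rm).indicator (fun _ => (k + (v y)⁻) ^ (p - 1) * k) x := by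
  have hp0 : 0 < p := by linarith
  rw [truncTest_eq_zero hp0 h (fun H => hy (ball_subset_ball hr H)), sub_zero]
  by_cases hxA : x ∈ sublevelBall v l x₀ rm
  · rw [indicator_of_mem hxA]
    have hl : 0 ≤ l := (hv0 x hx).trans hxA.2.le
    exact oddPow_mul_le_of_nonneg hp (hv0 x hx) (hxA.2.le.trans hlk) (truncTest_nonneg x)
      ((truncTest_le hp0 h hr hl hv0 x).trans hlk)
  · rw [indicator_of_notMem hxA]
    have : truncTest p l x₀ r' rm v x = 0 := by
      by_cases hxm : x ∈ ball x₀ rm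
      · exact truncTest_of_ge (not_lt.1 fun H => hxA ⟨hxm, H⟩)
      · exact truncTest_eq_zero hp0 h hxm
    rw [this, mul_zero]

/-- Pointwise upper bound for the integrand of the weak form tested with the truncation. -/
theorem oddPow_mul_truncTest_le (hp : 1 < p) (h : r' < rm) (hr : rm ≤ r) (hlk : l ≤ k) (hk : 0 ≤ k)
    (hv0 : ∀ x ∈ ball x₀ r, 0 ≤ v x) (x y : Rn N) :
    oddPow p (v x - v y) * (truncTest p l x₀ r' rm v x - truncTest p l x₀ r' rm v y) ≤
      (sublevelBall v l x₀ r ×ˢ sublevelBall v l x₀ r).indicator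
          (fun z => (p * k / (rm - r')) ^ p * ‖z.1 - z.2‖ ^ p) (x, y) +
        (sublevelBall v l x₀ rm ×ˢ (ball x₀ r)ᶜ).indicator
          (fun z => (k + (v z.2)⁻) ^ (p - 1) * k) (x, y) +
        (sublevelBall v l x₀ rm ×ˢ (ball x₀ r)ᶜ).indicator
          (fun z => (k + (v z.2)⁻) ^ (p - 1) * k) (y, x) := by
  have hp0 : 0 < p := by linarith
  have hη : 0 < rm - r' := by linarith
  have n1 : ∀ z, 0 ≤ (sublevelBall v l x₀ r ×ˢ sublevelBall v l x₀ r).indicator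
      (fun z => (p * k / (rm - r')) ^ p * ‖z.1 - z.2‖ ^ p) z := fun z =>
    indicator_nonneg (fun z _ => by positivity) z
  have n2 : ∀ z, 0 ≤ (sublevelBall v l x₀ rm ×ˢ (ball x₀ r)ᶜ).indicator
      (fun z => (k + (v z.2)⁻) ^ (p - 1) * k) z := fun z =>
    indicator_nonneg (fun z _ => by have := negPart_nonneg (v z.2); positivity) z
  by_cases hx : x ∈ ball x₀ r <;> by_cases hy : y ∈ ball x₀ r
  · have key : oddPow p (v x - v y) *
        (truncTest p l x₀ r' rm v x - truncTest p l x₀ r' rm v y) ≤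
        (sublevelBall v l x₀ r ×ˢ sublevelBall v l x₀ r).indicator
          (fun z => (p * k / (rm - r')) ^ p * ‖z.1 - z.2‖ ^ p) (x, y) := by
      rcases lt_or_ge (v x) l with hxl | hxl <;> rcases lt_or_ge (v y) l with hyl | hyl
      · rw [indicator_of_mem (show (x, y) ∈ sublevelBall v l x₀ r ×ˢ sublevelBall v l x₀ r from
          ⟨⟨hx, hxl⟩, hy, hyl⟩)]
        refine (oddPow_mul_truncTest_le_of_both hp h hxl hyl (hv0 x hx) (hv0 y hy)).trans ?_
        have hl : 0 ≤ l := (hv0 x hx).trans hxl.le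
        simp only
        gcongr
      · refine (oddPow_mul_truncTest_le_neg hp hxl.le hyl).trans (le_trans ?_ (n1 _))
        have := Real.rpow_nonneg (sub_nonneg.2 hxl.le) p
        have := Real.rpow_nonneg (cutoff_mem_Icc (x₀ := x₀) (r' := r') (r := rm) x).1 p
        rw [neg_nonpos]; positivity
      · rw [oddPow_mul_truncTest_swap]
        refine (oddPow_mul_truncTest_le_neg hp hyl.le hxl).trans (le_trans ?_ (n1 _))
        have := Real.rpow_nonneg (sub_nonneg.2 hyl.le) p
        have := Real.rpow_nonneg (cutoff_mem_Icc (x₀ := x₀) (r' := r') (r := rm) y).1 p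
        rw [neg_nonpos]; positivity
      · rw [truncTest_of_ge hxl, truncTest_of_ge hyl, sub_zero, mul_zero]
        exact n1 _
    linarith [n2 (x, y), n2 (y, x)]
  · have := oddPow_mul_truncTest_le_of_notMem hp h hr hlk hv0 hx hy
    have e : (sublevelBall v l x₀ rm).indicator (fun _ => (k + (v y)⁻) ^ (p - 1) * k) x =
        (sublevelBall v l x₀ rm ×ˢ (ball x₀ r)ᶜ).indicator
          (fun z => (k + (v z.2)⁻) ^ (p - 1) * k) (x, y) := by
      classical
      simp only [indicator_apply, mem_prod, mem_compl_iff, hy, not_false_eq_true, and_true]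
    linarith [n1 (x, y), n2 (y, x)]
  · have := oddPow_mul_truncTest_le_of_notMem hp h hr hlk hv0 hy hx
    have e : (sublevelBall v l x₀ rm).indicator (fun _ => (k + (v x)⁻) ^ (p - 1) * k) y =
        (sublevelBall v l x₀ rm ×ˢ (ball x₀ r)ᶜ).indicator
          (fun z => (k + (v z.2)⁻) ^ (p - 1) * k) (y, x) := by
      classical
      simp only [indicator_apply, mem_prod, mem_compl_iff, hx, not_false_eq_true, and_true]
    rw [oddPow_mul_truncTest_swap]
    linarith [n1 (x, y), n2 (x, y)]
  · rw [truncTest_eq_zero hp0 h (fun H => hx (ball_subset_ball hr H)),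
      truncTest_eq_zero hp0 h (fun H => hy (ball_subset_ball hr H)), sub_zero, mul_zero]
    linarith [n1 (x, y), n2 (x, y), n2 (y, x)]

/-- The good term: the cutoff is `1` at `x`, and `v` jumps by at least `l - l'` between the two
points. -/
theorem le_neg_oddPow_mul_truncTest (hp : 1 < p) (h : r' < rm) (hl : l' ≤ l) {x y : Rn N}
    (hx : x ∈ sublevelBall v l' x₀ r') (hy : l ≤ v y) :
    (l - l') ^ p ≤
      -(oddPow p (v x - v y) *
        (truncTest p l x₀ r' rm v x - truncTest p l x₀ r' rm v y)) := by
  have h1 := oddPow_mul_truncTest_le_neg (x₀ := x₀) (r' := r') (rm := rm) hp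
    (hx.2.le.trans hl) hy
  rw [cutoff_eq_one h hx.1, Real.one_rpow, mul_one] at h1
  have h2 : (l - l') ^ p ≤ (l - v x) ^ p :=
    Real.rpow_le_rpow (by linarith) (by linarith [hx.2]) (by linarith)
  linarith

/-- Recasts the sign of the weak form as a comparison in `[0, ∞]`, so that the good and bad terms
can be bounded separately without further integrability checks. -/
theorem lintegral_ofReal_neg_le_of_integral_nonneg {X : Type*} [MeasurableSpace X] {μ : Measure X}
    {Q : X → ℝ} (hQ : Integrable Q μ) (h : 0 ≤ ∫ z, Q z ∂μ) :
    ∫⁻ z, ENNReal.ofReal (-Q z) ∂μ ≤ ∫⁻ z, ENNReal.ofReal (Q z) ∂μ := by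
  rw [integral_eq_lintegral_pos_part_sub_lintegral_neg_part hQ, sub_nonneg] at h
  refine (ENNReal.toReal_le_toReal ?_ ?_).1 h
  · have := hQ.neg.lintegral_lt_top; simpa using this.ne
  · exact hQ.lintegral_lt_top.ne

variable {s Λ₁ Λ₂ : ℝ} {K : Rn N → Rn N → ℝ} {Ω : Set (Rn N)} {R : ℝ}

/-- Energy estimate: the interaction of a lower sublevel set with the complement of a higher one
is controlled by the local energy of the cutoff and the tail. -/
theorem energy_estimate (hN : 1 ≤ N) (hp : 1 < p) (hs₀ : 0 < s) (hs₁ : s < 1) (hΛ : 0 < Λ₁)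
    (hΛ₂ : Λ₁ ≤ Λ₂) (hK : IsKernel p s Λ₁ Λ₂ K)
    (hv : HasFiniteEnergy p ((N : ℝ) + p * s) v x₀ R) (hv0 : ∀ x ∈ ball x₀ R, 0 ≤ v x)
    (hΩ : ball x₀ R ⊆ Ω) (hw : ∀ ψ, IsTestFunction Ω ψ → 0 ≤ weakForm p K v ψ)
    (hr' : r' < rm) (hrm : rm < r) (hrR : r ≤ R) (hr0 : 0 < r)
    (hl' : 0 ≤ l') (hl : l' ≤ l) (hlk : l ≤ k) :
    ENNReal.ofReal (Λ₁ * (l - l') ^ p) *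
      ∫⁻ z in sublevelBall v l' x₀ r' ×ˢ (sublevelBall v l x₀ r)ᶜ,
        ENNReal.ofReal (1 / ‖z.1 - z.2‖ ^ ((N : ℝ) + p * s)) ≤
    ENNReal.ofReal (Λ₂ * (p * k / (rm - r')) ^ p) *
      (∫⁻ z in sublevelBall v l x₀ r ×ˢ sublevelBall v l x₀ r,
        ENNReal.ofReal (‖z.1 - z.2‖ ^ p / ‖z.1 - z.2‖ ^ ((N : ℝ) + p * s))) +
    ENNReal.ofReal (3 * Λ₂) *
      ∫⁻ z in sublevelBall v l x₀ rm ×ˢ (ball x₀ r)ᶜ,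
        ENNReal.ofReal ((k + (v z.2)⁻) ^ (p - 1) * k / ‖z.1 - z.2‖ ^ ((N : ℝ) + p * s)) := by
  set d := (N : ℝ) + p * s with hd
  have hp0 : 0 < p := by linarith
  have hps : 0 < p * s := by positivity
  have hN0 : (0 : ℝ) ≤ N := by positivity
  have hd0 : d ≠ 0 := by linarith
  -- This is where `s < 1` enters.
  have hdp : d < N + p := by rw [hd]; nlinarith
  have hl0 : 0 ≤ l := hl'.trans hl
  have hk : 0 ≤ k := hl0.trans hlk
  have hΛ₂0 : 0 < Λ₂ := hΛ.trans_le hΛ₂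
  have hη : 0 < rm - r' := by linarith
  have hvm := hv.measurable
  have hnm := measurable_negPart_comp hvm
  have hv0r : ∀ x ∈ ball x₀ r, 0 ≤ v x := fun x hx => hv0 x (ball_subset_ball hrR hx)
  set φ := truncTest p l x₀ r' rm v
  obtain ⟨hQint, hQ⟩ := (isRoughTestFunction_truncTest hN hp hdp hr' (hrm.le.trans hrR)
    (hr0.trans_le hrR) hl0 hv hv0).integral_flux_nonneg hp hΛ (by linarith) hK hv
    (hrm.trans_le hrR) hΩ hw
  set Q : Rn N × Rn N → ℝ := fun z => flux p K v z * (φ z.1 - φ z.2)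
  have hQeq : ∀ z, Q z = oddPow p (v z.1 - v z.2) * (φ z.1 - φ z.2) * K z.1 z.2 := fun z => by
    simp only [Q, flux]; ring
  set A := sublevelBall v l x₀ r
  set A' := sublevelBall v l' x₀ r'
  set Am := sublevelBall v l x₀ rm
  have mA : MeasurableSet A := measurableSet_sublevelBall hvm
  have mA' : MeasurableSet A' := measurableSet_sublevelBall hvm
  have mAm : MeasurableSet Am := measurableSet_sublevelBall hvm
  have mB : MeasurableSet (ball x₀ r)ᶜ := measurableSet_ball.compl
  set D : Rn N × Rn N → ℝ := (A ×ˢ A).indicator fun z =>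
    (p * k / (rm - r')) ^ p * ‖z.1 - z.2‖ ^ p with hD
  set E : Rn N × Rn N → ℝ := (Am ×ˢ (ball x₀ r)ᶜ).indicator fun z =>
    (k + (v z.2)⁻) ^ (p - 1) * k with hE
  have hD0 : ∀ z, 0 ≤ D z := fun z => indicator_nonneg (fun z _ => by positivity) z
  have hE0 : ∀ z, 0 ≤ E z := fun z =>
    indicator_nonneg (fun z _ => by have := negPart_nonneg (v z.2); positivity) z
  have mD : Measurable D := Measurable.indicator (by fun_prop) (mA.prod mA)
  have mE : Measurable E := Measurable.indicator (by fun_prop) (mAm.prod mB)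
  set κ : Rn N × Rn N → ℝ := fun z => 1 / ‖z.1 - z.2‖ ^ d with hκ
  have hκ0 : ∀ z, 0 ≤ κ z := fun z => by positivity
  have mκ : Measurable κ := by fun_prop
  have hup : ∀ᵐ z : Rn N × Rn N, ENNReal.ofReal (Q z) ≤
      ENNReal.ofReal (Λ₂ * (D z * κ z)) + ENNReal.ofReal (Λ₂ * (E z * κ z)) +
        ENNReal.ofReal (Λ₂ * (E z.swap * κ z.swap)) := by
    filter_upwards [hK.ae_bounds hΛ hd0] with z hz
    have hsw : κ z.swap = κ z := by simp only [hκ, Prod.fst_swap, Prod.snd_swap, norm_sub_rev]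
    have := hκ0 z
    have := hE0 z
    have := hE0 z.swap
    have := hD0 z
    rw [hsw, ← ENNReal.ofReal_add (by positivity) (by positivity),
      ← ENNReal.ofReal_add (by positivity) (by positivity)]
    refine ENNReal.ofReal_le_ofReal ?_
    rw [hQeq]
    have hpt := oddPow_mul_truncTest_le hp hr' hrm.le hlk hk hv0r z.1 z.2
    have hK0 : 0 ≤ K z.1 z.2 := le_trans (by positivity) hz.2.1
    calc _ ≤ (D z + E z + E z.swap) * K z.1 z.2 := mul_le_mul_of_nonneg_right hpt hK0
      _ ≤ (D z + E z + E z.swap) * (Λ₂ * κ z) := by gcongr; exact hz.2.2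
      _ = _ := by ring
  have hlow : ∀ᵐ z : Rn N × Rn N, ENNReal.ofReal (Λ₁ * (l - l') ^ p) *
      (A' ×ˢ Aᶜ).indicator (fun z => ENNReal.ofReal (κ z)) z ≤
      ENNReal.ofReal (-Q z) + ENNReal.ofReal (Λ₂ * (E z * κ z)) := by
    filter_upwards [hK.ae_bounds hΛ hd0] with z hz
    by_cases hzA : z ∈ A' ×ˢ Aᶜ
    · rw [indicator_of_mem hzA, ← ENNReal.ofReal_mul (mul_nonneg hΛ.le
        (Real.rpow_nonneg (sub_nonneg.2 hl) _))]
      by_cases hzB : z.2 ∈ ball x₀ r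
      · refine le_trans (ENNReal.ofReal_le_ofReal ?_) le_self_add
        have hvz : l ≤ v z.2 := not_lt.1 fun H => hzA.2 ⟨hzB, H⟩
        have h1 := le_neg_oddPow_mul_truncTest hp hr' hl hzA.1 hvz
        rw [hQeq, ← neg_mul]
        calc Λ₁ * (l - l') ^ p * κ z = (l - l') ^ p * (Λ₁ * κ z) := by ring
          _ ≤ _ := mul_le_mul h1 hz.2.1 (mul_nonneg hΛ.le (hκ0 z))
            ((Real.rpow_nonneg (sub_nonneg.2 hl) _).trans h1)
      -- For an exterior point `y` there is no jump to exploit. The interaction is dominated by the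
      -- tail term `E`, using `l - l' ≤ k`.
      · refine le_trans (ENNReal.ofReal_le_ofReal ?_) le_add_self
        have hEz : E z = (k + (v z.2)⁻) ^ (p - 1) * k :=
          indicator_of_mem (show z ∈ Am ×ˢ (ball x₀ r)ᶜ from
            ⟨sublevelBall_mono hl hr'.le hzA.1, hzB⟩) _
        have h1 : (l - l') ^ p ≤ E z := by
          rw [hEz]
          have h2 : (l - l') ^ p = (l - l') ^ (p - 1) * (l - l') := by
            rw [← Real.rpow_add_one' (sub_nonneg.2 hl) (by linarith)]; simp
          have h3 := negPart_nonneg (v z.2)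
          rw [h2]
          have : 0 ≤ l - l' := sub_nonneg.2 hl
          gcongr <;> linarith
        rw [mul_assoc]
        have := hκ0 z
        have := hE0 z
        have : 0 ≤ (l - l') ^ p := Real.rpow_nonneg (sub_nonneg.2 hl) _
        gcongr
    · rw [indicator_of_notMem hzA, mul_zero]
      exact zero_le
  have iE : ∫⁻ z, ENNReal.ofReal (Λ₂ * (E z * κ z)) = ENNReal.ofReal Λ₂ *
      ∫⁻ z in Am ×ˢ (ball x₀ r)ᶜ,
        ENNReal.ofReal ((k + (v z.2)⁻) ^ (p - 1) * k / ‖z.1 - z.2‖ ^ d) := by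
    rw [← lintegral_indicator (mAm.prod mB),
      ← lintegral_const_mul _ (Measurable.indicator (by fun_prop) (mAm.prod mB))]
    refine lintegral_congr fun z => ?_
    rw [ENNReal.ofReal_mul hΛ₂0.le]
    congr 1
    by_cases hz : z ∈ Am ×ˢ (ball x₀ r)ᶜ
    · rw [hE, indicator_of_mem hz, indicator_of_mem hz]
      simp only [hκ, mul_one_div]
    · rw [hE, indicator_of_notMem hz, indicator_of_notMem hz]; simp
  have iE' : ∫⁻ z : Rn N × Rn N, ENNReal.ofReal (Λ₂ * (E z.swap * κ z.swap)) =
      ∫⁻ z, ENNReal.ofReal (Λ₂ * (E z * κ z)) :=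
    lintegral_prod_swap (μ := (volume : Measure (Rn N))) (ν := (volume : Measure (Rn N)))
      (fun z => ENNReal.ofReal (Λ₂ * (E z * κ z)))
  have iD : ∫⁻ z, ENNReal.ofReal (Λ₂ * (D z * κ z)) =
      ENNReal.ofReal (Λ₂ * (p * k / (rm - r')) ^ p) *
      ∫⁻ z in A ×ˢ A, ENNReal.ofReal (‖z.1 - z.2‖ ^ p / ‖z.1 - z.2‖ ^ d) := by
    rw [← lintegral_indicator (mA.prod mA),
      ← lintegral_const_mul _ (Measurable.indicator (by fun_prop) (mA.prod mA))]
    refine lintegral_congr fun z => ?_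
    by_cases hz : z ∈ A ×ˢ A
    · rw [hD, indicator_of_mem hz, indicator_of_mem hz, ← ENNReal.ofReal_mul (by positivity)]
      congr 1
      simp only [hκ]
      ring
    · rw [hD, indicator_of_notMem hz, indicator_of_notMem hz]; simp
  set I := ∫⁻ z in Am ×ˢ (ball x₀ r)ᶜ,
    ENNReal.ofReal ((k + (v z.2)⁻) ^ (p - 1) * k / ‖z.1 - z.2‖ ^ d)
  calc ENNReal.ofReal (Λ₁ * (l - l') ^ p) * ∫⁻ z in A' ×ˢ Aᶜ, ENNReal.ofReal (κ z)
      = ∫⁻ z, ENNReal.ofReal (Λ₁ * (l - l') ^ p) *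
          (A' ×ˢ Aᶜ).indicator (fun z => ENNReal.ofReal (κ z)) z := by
        rw [lintegral_const_mul _ (Measurable.indicator (by fun_prop) (mA'.prod mA.compl)),
          lintegral_indicator (mA'.prod mA.compl)]
    _ ≤ ∫⁻ z, (ENNReal.ofReal (-Q z) + ENNReal.ofReal (Λ₂ * (E z * κ z))) :=
        lintegral_mono_ae hlow
    _ = (∫⁻ z, ENNReal.ofReal (-Q z)) + ENNReal.ofReal Λ₂ * I := by
        rw [lintegral_add_right _ (by fun_prop), iE]
    _ ≤ (∫⁻ z, ENNReal.ofReal (Q z)) + ENNReal.ofReal Λ₂ * I := by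
        gcongr ?_ + _
        exact lintegral_ofReal_neg_le_of_integral_nonneg hQint hQ
    _ ≤ (∫⁻ z, (ENNReal.ofReal (Λ₂ * (D z * κ z)) + ENNReal.ofReal (Λ₂ * (E z * κ z)) +
        ENNReal.ofReal (Λ₂ * (E z.swap * κ z.swap)))) + ENNReal.ofReal Λ₂ * I := by
        gcongr ?_ + _
        exact lintegral_mono_ae hup
    -- The factor `3` counts the exterior term twice in the upper bound (`x` or `y` outside) and
    -- once in the lower bound.
    _ = _ := by
        rw [lintegral_add_right _ (by fun_prop), lintegral_add_right _ (by fun_prop), iE', iE, iD,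
          ENNReal.ofReal_mul (by norm_num : (0 : ℝ) ≤ 3)]
        have : ENNReal.ofReal 3 = 3 := by simp
        rw [this]
        ring

end EnergyEstimate

/-! ### The De Giorgi iteration. -/

section DeGiorgiIteration

variable {N : ℕ}

/-- Hypotheses on a function under which the De Giorgi iteration in `ball x₀ ρ` runs. -/
structure DeGiorgiSetting (p s Λ₁ Λ₂ T : ℝ) (K : Rn N → Rn N → ℝ) (Ω : Set (Rn N)) (v : Rn N → ℝ)
    (x₀ : Rn N) (ρ R k : ℝ) : Prop where
  kernel : IsKernel p s Λ₁ Λ₂ K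
  energy : HasFiniteEnergy p ((N : ℝ) + p * s) v x₀ R
  nonneg : ∀ x ∈ ball x₀ R, 0 ≤ v x
  subset : ball x₀ R ⊆ Ω
  weak : ∀ ψ, IsTestFunction Ω ψ → 0 ≤ weakForm p K v ψ
  pos : 0 < ρ
  lt : ρ < R
  level_pos : 0 < k
  tail_le : ∫⁻ y in (ball x₀ ρ)ᶜ,
    ENNReal.ofReal ((v y)⁻ ^ (p - 1) / ‖y - x₀‖ ^ ((N : ℝ) + p * s)) ≤
      ENNReal.ofReal (T * k ^ (p - 1) * ρ ^ (-(p * s)))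

theorem volume_ball_eq_ofReal (hN : 1 ≤ N) (x : Rn N) {t : ℝ} (ht : 0 ≤ t) :
    volume (ball x t) = ENNReal.ofReal (t ^ N * volume.real (ball (0 : Rn N) 1)) := by
  have : Nonempty (Fin N) := ⟨⟨0, hN⟩⟩
  rw [Measure.addHaar_ball _ _ ht, finrank_euclideanSpace, Fintype.card_fin,
    ENNReal.ofReal_mul (by positivity), Measure.real,
    ENNReal.ofReal_toReal measure_ball_lt_top.ne]

theorem volumeReal_ball_eq (hN : 1 ≤ N) (x : Rn N) {t : ℝ} (ht : 0 ≤ t) :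
    volume.real (ball x t) = t ^ N * volume.real (ball (0 : Rn N) 1) := by
  rw [Measure.real, volume_ball_eq_ofReal hN x ht, ENNReal.toReal_ofReal]
  positivity

theorem volumeReal_ball_pos (x : Rn N) {t : ℝ} (ht : 0 < t) : 0 < volume.real (ball x t) :=
  ENNReal.toReal_pos (measure_ball_pos _ _ ht).ne' measure_ball_lt_top.ne

variable {p s Λ₁ Λ₂ T : ℝ}

theorem exists_energy_le (hN : 1 ≤ N) (hp : 1 < p) (hs₀ : 0 < s) (hs₁ : s < 1) (hΛ : 0 < Λ₁)
    (hΛ₂ : Λ₁ ≤ Λ₂) (hT : 0 ≤ T) :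
    ∃ C : ℝ, 0 < C ∧ ∀ (K : Rn N → Rn N → ℝ) (Ω : Set (Rn N)) (v : Rn N → ℝ) (x₀ : Rn N)
      (ρ R k : ℝ), DeGiorgiSetting p s Λ₁ Λ₂ T K Ω v x₀ ρ R k →
      ∀ l' l r' r : ℝ, 0 ≤ l' → l' ≤ l → l ≤ k → r' < r → ρ / 2 ≤ r' → r ≤ ρ →
      ENNReal.ofReal (Λ₁ * (l - l') ^ p) *
        ∫⁻ z in sublevelBall v l' x₀ r' ×ˢ (sublevelBall v l x₀ r)ᶜ,
          ENNReal.ofReal (1 / ‖z.1 - z.2‖ ^ ((N : ℝ) + p * s)) ≤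
      ENNReal.ofReal (C * k ^ p * (ρ / (r - r')) ^ (p + ((N : ℝ) + p * s)) * ρ ^ (-(p * s))) *
        volume (sublevelBall v l x₀ r) := by
  set d := (N : ℝ) + p * s with hd
  have hp0 : 0 < p := by linarith
  have hps : 0 < p * s := by positivity
  have hpsp : p * s < p := by nlinarith
  have hN0 : (0 : ℝ) ≤ N := by positivity
  have hd0 : 0 < d := by linarith
  have hΛ₂0 : 0 < Λ₂ := hΛ.trans_le hΛ₂
  obtain ⟨C₁, hC₁, h₁⟩ := exists_lintegral_prod_norm_rpow_le hN hp0 (d := d) (by linarith)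
  obtain ⟨C₂, hC₂, h₂⟩ := exists_lintegral_tail_le (N := N) hp hs₀ hT
  refine ⟨Λ₂ * (2 * p) ^ p * (C₁ * 2 ^ (p - p * s)) + 3 * Λ₂ * (C₂ * 2 ^ d), by positivity, ?_⟩
  intro K Ω v x₀ ρ R k h l' l r' r hl'0 hl hlk hr hr'ρ hrρ
  have hρ := h.pos
  have hk := h.level_pos
  have hη : 0 < r - r' := by linarith
  have hr0 : 0 < r := by linarith
  -- The gap `r - r'` is shared equally: one half for the slope of the cutoff, which costs `θ^p`,
  -- the other to separate its support from the exterior, which costs `θ^d`. As `θ ≥ 1`, both are at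
  -- most `θ^(p + d)`.
  set rm := (r + r') / 2 with hrm
  have e1 : rm - r' = (r - r') / 2 := by rw [hrm]; ring
  have e2 : r - rm = (r - r') / 2 := by rw [hrm]; ring
  have hθ : 1 ≤ ρ / (r - r') := by rw [one_le_div hη]; linarith
  have key := energy_estimate hN hp hs₀ hs₁ hΛ hΛ₂ h.kernel h.energy h.nonneg h.subset h.weak
    (r' := r') (rm := rm) (r := r) (by linarith) (by linarith) (by linarith [h.lt]) hr0 hl'0 hl hlk
  have n₁ := h₁ x₀ r hr0 (sublevelBall v l x₀ r) sublevelBall_subset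
  have n₂ := h₂ v x₀ ρ k h.energy.measurable hρ hk
    (fun x hx => h.nonneg x (ball_subset_ball h.lt.le hx)) h.tail_le rm r (by linarith)
    (by linarith) hrρ (sublevelBall v l x₀ rm) sublevelBall_subset
  have hsub : volume (sublevelBall v l x₀ rm) ≤ volume (sublevelBall v l x₀ r) :=
    measure_mono (sublevelBall_mono le_rfl (by linarith))
  set θ := ρ / (r - r') with hθdef
  have hθ0 : 0 < θ := by linarith
  have eθ : r - r' = ρ / θ := by rw [hθdef]; field_simp
  set a := volume (sublevelBall v l x₀ r)
  have b₁ : Λ₂ * (p * k / (rm - r')) ^ p * (C₁ * (2 * r) ^ ((N : ℝ) + (p - d))) ≤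
      Λ₂ * (2 * p) ^ p * (C₁ * 2 ^ (p - p * s)) * k ^ p * θ ^ (p + d) * ρ ^ (-(p * s)) := by
    have e3 : (N : ℝ) + (p - d) = p - p * s := by rw [hd]; ring
    have e4 : p * k / (rm - r') = 2 * p * k * θ / ρ := by
      rw [e1, eθ]; field_simp
    have h5 : (2 * r) ^ (p - p * s) ≤ 2 ^ (p - p * s) * (ρ ^ p * ρ ^ (-(p * s))) := by
      rw [← Real.rpow_add hρ, ← sub_eq_add_neg, ← Real.mul_rpow (by norm_num) hρ.le]
      exact Real.rpow_le_rpow (by positivity) (by linarith) (by linarith)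
    have h6 : θ ^ p ≤ θ ^ (p + d) := Real.rpow_le_rpow_of_exponent_le hθ (by linarith)
    rw [e3, e4, Real.div_rpow (by positivity) hρ.le, Real.mul_rpow (by positivity) hθ0.le,
      Real.mul_rpow (by positivity) hk.le]
    calc Λ₂ * ((2 * p) ^ p * k ^ p * θ ^ p / ρ ^ p) * (C₁ * (2 * r) ^ (p - p * s))
        ≤ Λ₂ * ((2 * p) ^ p * k ^ p * θ ^ (p + d) / ρ ^ p) *
          (C₁ * (2 ^ (p - p * s) * (ρ ^ p * ρ ^ (-(p * s))))) := by gcongr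
      _ = _ := by
          have : 0 < ρ ^ p := by positivity
          field_simp
  have b₂ : 3 * Λ₂ * (C₂ * (ρ / (r - rm)) ^ d * k ^ p * ρ ^ (-(p * s))) ≤
      3 * Λ₂ * (C₂ * 2 ^ d) * k ^ p * θ ^ (p + d) * ρ ^ (-(p * s)) := by
    have e4 : ρ / (r - rm) = 2 * θ := by
      rw [e2, eθ]; field_simp
    have h6 : θ ^ d ≤ θ ^ (p + d) := Real.rpow_le_rpow_of_exponent_le hθ (by linarith)
    rw [e4, Real.mul_rpow (by norm_num) hθ0.le]
    calc 3 * Λ₂ * (C₂ * (2 ^ d * θ ^ d) * k ^ p * ρ ^ (-(p * s)))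
        ≤ 3 * Λ₂ * (C₂ * (2 ^ d * θ ^ (p + d)) * k ^ p * ρ ^ (-(p * s))) := by gcongr
      _ = _ := by ring
  have hrm0 : 0 < rm - r' := by rw [e1]; positivity
  have hrm1 : 0 < r - rm := by rw [e2]; positivity
  calc _ ≤ _ := key
    _ ≤ ENNReal.ofReal (Λ₂ * (p * k / (rm - r')) ^ p) *
          (ENNReal.ofReal (C₁ * (2 * r) ^ ((N : ℝ) + (p - d))) * a) +
        ENNReal.ofReal (3 * Λ₂) *
          (ENNReal.ofReal (C₂ * (ρ / (r - rm)) ^ d * k ^ p * ρ ^ (-(p * s))) * a) := by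
        gcongr
        exact n₂.trans (by gcongr)
    _ = ENNReal.ofReal (Λ₂ * (p * k / (rm - r')) ^ p * (C₁ * (2 * r) ^ ((N : ℝ) + (p - d))) +
          3 * Λ₂ * (C₂ * (ρ / (r - rm)) ^ d * k ^ p * ρ ^ (-(p * s)))) * a := by
        rw [← mul_assoc, ← mul_assoc, ← add_mul, ← ENNReal.ofReal_mul (by positivity),
          ← ENNReal.ofReal_mul (by positivity), ← ENNReal.ofReal_add (by positivity)
          (by positivity)]
    _ ≤ _ := by
        gcongr
        linarith

/-- One step of the De Giorgi iteration. -/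
theorem exists_sublevelBall_decay (hN : 1 ≤ N) (hp : 1 < p) (hs₀ : 0 < s) (hs₁ : s < 1)
    (hΛ : 0 < Λ₁) (hΛ₂ : Λ₁ ≤ Λ₂) (hT : 0 ≤ T) :
    ∃ C : ℝ, 0 < C ∧ ∀ (K : Rn N → Rn N → ℝ) (Ω : Set (Rn N)) (v : Rn N → ℝ) (x₀ : Rn N)
      (ρ R k : ℝ), DeGiorgiSetting p s Λ₁ Λ₂ T K Ω v x₀ ρ R k →
      ∀ l' l r' r : ℝ, 0 ≤ l' → l' < l → l ≤ k → r' < r → ρ / 2 ≤ r' → r ≤ ρ →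
      volume.real (sublevelBall v l' x₀ r') / volume.real (ball x₀ ρ) ≤
        C * (k / (l - l')) ^ p * (ρ / (r - r')) ^ (p + ((N : ℝ) + p * s)) *
          (volume.real (sublevelBall v l x₀ r) / volume.real (ball x₀ ρ)) ^
            (((N : ℝ) + p * s) / N) := by
  obtain ⟨C, hC, hCE⟩ := exists_energy_le hN hp hs₀ hs₁ hΛ hΛ₂ hT
  set d := (N : ℝ) + p * s with hd
  have hp0 : 0 < p := by linarith
  have hps : 0 < p * s := by positivity
  have hN0 : (0 : ℝ) < N := by exact_mod_cast hN
  have hd0 : 0 < d := by linarith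
  set ω := volume.real (ball (0 : Rn N) 1)
  have hω : 0 < ω := volumeReal_ball_pos 0 one_pos
  refine ⟨C * 2 ^ (d / N) / (Λ₁ * ω), by positivity, ?_⟩
  intro K Ω v x₀ ρ R k h l' l r' r hl'0 hl hlk hr hr'ρ hrρ
  have hE := hCE K Ω v x₀ ρ R k h l' l r' r hl'0 hl.le hlk hr hr'ρ hrρ
  have hρ := h.pos
  have hk := h.level_pos
  have hη : 0 < r - r' := by linarith
  have hll : 0 < l - l' := by linarith
  have hV : volume.real (ball x₀ ρ) = ρ ^ N * ω := volumeReal_ball_eq hN x₀ hρ.le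
  have hA := measurableSet_sublevelBall (l := l) (x₀ := x₀) (r := r) h.energy.measurable
  have hA' := measurableSet_sublevelBall (l := l') (x₀ := x₀) (r := r') h.energy.measurable
  have hAA' : sublevelBall v l' x₀ r' ⊆ sublevelBall v l x₀ r := sublevelBall_mono hl.le hr.le
  set A := sublevelBall v l x₀ r
  set A' := sublevelBall v l' x₀ r'
  have hAfin : volume A ≠ ∞ :=
    ((measure_mono sublevelBall_subset).trans_lt measure_ball_lt_top).ne
  have hA'fin : volume A' ≠ ∞ := ((measure_mono hAA').trans_lt hAfin.lt_top).ne
  -- A null set `A` is treated apart, since `|A|` is cancelled later and the radius `t` must be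
  -- positive.
  rcases eq_or_ne (volume A) 0 with hA0 | hA0
  · have : volume.real A' = 0 := by
      rw [Measure.real, measure_mono_null hAA' hA0, ENNReal.toReal_zero]
    rw [this, zero_div]
    positivity
  set a := volume.real A with ha
  have ha0 : 0 < a := ENNReal.toReal_pos hA0 hAfin
  have haE : volume A = ENNReal.ofReal a := (ENNReal.ofReal_toReal hAfin).symm
  set Y := a / volume.real (ball x₀ ρ) with hY
  have hY0 : 0 < Y := div_pos ha0 (by rw [hV]; positivity)
  -- The radius with `|B_t| = 2|A|`.
  set t := ρ * (2 * Y) ^ (1 / (N : ℝ)) with ht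
  have ht0 : 0 < t := by positivity
  have htN : t ^ N * ω = 2 * a := by
    rw [ht, mul_pow, ← Real.rpow_natCast ((2 * Y) ^ (1 / (N : ℝ))), ← Real.rpow_mul (by positivity),
      one_div_mul_cancel hN0.ne', Real.rpow_one, hY, hV]
    field_simp
  have htd : t ^ d = ρ ^ N * ρ ^ (p * s) * (2 ^ (d / N) * Y ^ (d / N)) := by
    rw [ht, Real.mul_rpow hρ.le (by positivity), ← Real.rpow_mul (by positivity),
      one_div_mul_eq_div, Real.mul_rpow (by norm_num) hY0.le, hd, Real.rpow_add hρ,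
      Real.rpow_natCast]
  have hball : ∀ x : Rn N, volume (ball x t) / 2 = volume A := fun x => by
    rw [volume_ball_eq_ofReal hN x ht0.le, htN, haE, ENNReal.ofReal_mul (by norm_num)]
    have : ENNReal.ofReal 2 = 2 := by simp
    rw [this, mul_comm, ENNReal.mul_div_cancel_right (by norm_num) (by norm_num)]
  have hlow : volume A' * (ENNReal.ofReal (1 / t ^ d) * volume A) ≤
      ∫⁻ z in A' ×ˢ Aᶜ, ENNReal.ofReal (1 / ‖z.1 - z.2‖ ^ d) := by
    rw [Measure.volume_eq_prod, setLIntegral_prod _ (by fun_prop), mul_comm, ← setLIntegral_const]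
    refine lintegral_mono fun x => ?_
    have := le_setLIntegral_compl_one_div_norm_rpow hN hd0.le (E := A) x (r := t) (hball x).ge
    rwa [hball x] at this
  set θ := ρ / (r - r') with hθ
  have hθ0 : 0 < θ := by positivity
  have hreal : Λ₁ * (l - l') ^ p * (volume.real A' * (1 / t ^ d)) ≤
      C * k ^ p * θ ^ (p + d) * ρ ^ (-(p * s)) := by
    have h1 : ENNReal.ofReal (Λ₁ * (l - l') ^ p) * (volume A' * ENNReal.ofReal (1 / t ^ d)) *
        volume A ≤ ENNReal.ofReal (C * k ^ p * θ ^ (p + d) * ρ ^ (-(p * s))) * volume A := by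
      refine le_trans ?_ hE
      rw [mul_assoc, mul_assoc]
      exact mul_le_mul_right hlow _
    -- One factor `|A|` comes from the kernel lower bound and one from the energy estimate. After
    -- they cancel, `|A'|` is bounded by a multiple of `t^d`, and `t^d` is proportional to `Y^(d/N)`
    -- with `d/N = 1 + ps/N > 1`.
    have h2 := (ENNReal.mul_le_mul_iff_left hA0 hAfin).1 h1
    rw [← ENNReal.ofReal_toReal hA'fin, ← ENNReal.ofReal_mul ENNReal.toReal_nonneg,
      ← ENNReal.ofReal_mul (by positivity)] at h2
    exact (ENNReal.ofReal_le_ofReal_iff (by positivity)).1 h2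
  rw [mul_one_div, htd, ← mul_div_assoc, div_le_iff₀ (by positivity)] at hreal
  have hρps : ρ ^ (-(p * s)) * ρ ^ (p * s) = 1 := by
    rw [← Real.rpow_add hρ]; simp
  rw [hV, div_le_iff₀ (by positivity), Real.div_rpow hk.le hll.le]
  have e1 : C * k ^ p * θ ^ (p + d) * ρ ^ (-(p * s)) *
      (ρ ^ N * ρ ^ (p * s) * (2 ^ (d / N) * Y ^ (d / N))) =
      C * k ^ p * θ ^ (p + d) * ρ ^ N * (2 ^ (d / N) * Y ^ (d / N)) *
        (ρ ^ (-(p * s)) * ρ ^ (p * s)) := by ring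
  rw [e1, hρps, mul_one] at hreal
  have hlp : 0 < (l - l') ^ p := by positivity
  have e2 : C * 2 ^ (d / N) / (Λ₁ * ω) * (k ^ p / (l - l') ^ p) * θ ^ (p + d) * Y ^ (d / N) *
      (ρ ^ N * ω) = C * k ^ p * θ ^ (p + d) * ρ ^ N * (2 ^ (d / N) * Y ^ (d / N)) /
        (Λ₁ * (l - l') ^ p) := by
    field_simp
  rw [e2, le_div_iff₀ (by positivity)]
  linarith

/-- Fast geometric convergence. -/
theorem le_mul_pow_of_superlinear_recursion {Y : ℕ → ℝ} {C b β ν q : ℝ} (hC : 0 ≤ C) (hb : 0 ≤ b)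
    (hβ : 0 ≤ β) (hν : 0 < ν) (hq : 0 < q) (hY : ∀ n, 0 ≤ Y n)
    (hrec : ∀ n, Y (n + 1) ≤ C * b ^ n * Y n ^ (1 + β)) (hbq : b * q ^ β ≤ 1)
    (hCν : C * ν ^ β ≤ q) (h0 : Y 0 ≤ ν) (n : ℕ) : Y n ≤ ν * q ^ n := by
  induction n with
  | zero => simpa using h0
  | succ n ih =>
    have hx : 0 < ν * q ^ n := by positivity
    calc Y (n + 1) ≤ C * b ^ n * Y n ^ (1 + β) := hrec n
      _ ≤ C * b ^ n * (ν * q ^ n) ^ (1 + β) := by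
          have := hY n
          gcongr
      -- The two conditions on `ν` and `q` separate: `b q^β ≤ 1` absorbs the geometric growth, and
      -- `C ν^β ≤ q` yields the next factor `q`.
      _ = (C * ν ^ β) * (b * q ^ β) ^ n * (ν * q ^ n) := by
          have : (q ^ n) ^ β = (q ^ β) ^ n := by
            rw [← Real.rpow_natCast q, ← Real.rpow_mul hq.le, mul_comm, Real.rpow_mul hq.le,
              Real.rpow_natCast]
          rw [Real.rpow_add hx, Real.rpow_one, Real.mul_rpow hν.le (by positivity), this, mul_pow]
          ring
      _ ≤ q * 1 * (ν * q ^ n) := by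
          have : (b * q ^ β) ^ n ≤ 1 := pow_le_one₀ (by positivity) hbq
          gcongr
      _ = ν * q ^ (n + 1) := by ring

theorem exists_deGiorgi_smallness (hN : 1 ≤ N) (hp : 1 < p) (hs₀ : 0 < s) (hs₁ : s < 1)
    (hΛ : 0 < Λ₁) (hΛ₂ : Λ₁ ≤ Λ₂) (hT : 0 ≤ T) :
    ∃ ν : ℝ, 0 < ν ∧ ν < 1 ∧ ∀ (K : Rn N → Rn N → ℝ) (Ω : Set (Rn N)) (v : Rn N → ℝ) (x₀ : Rn N)
      (ρ R k : ℝ), DeGiorgiSetting p s Λ₁ Λ₂ T K Ω v x₀ ρ R k →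
      volume.real (sublevelBall v k x₀ ρ) ≤ ν * volume.real (ball x₀ ρ) →
      volume (sublevelBall v (3 * k / 4) x₀ (ρ / 2)) = 0 := by
  obtain ⟨C, hC, hdec⟩ := exists_sublevelBall_decay (N := N) hN hp hs₀ hs₁ hΛ hΛ₂ hT
  set d := (N : ℝ) + p * s with hd
  have hp0 : 0 < p := by linarith
  have hps : 0 < p * s := by positivity
  have hN0 : (0 : ℝ) < N := by exact_mod_cast hN
  have hd0 : 0 < d := by linarith
  set β := p * s / N with hβ
  have hβ0 : 0 < β := by positivity
  have hdN : d / N = 1 + β := by rw [hd, hβ]; field_simp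
  -- At step `n` the level gap is `k / (8 · 2^n)`, with power `p`, and the radius gap is `ρ / (4 ·
  -- 2^n)`, with power `p + d`. The powers of `2^n` form `b^n`; the powers of `8` and `4` go into
  -- `C'`.
  set b := (2 : ℝ) ^ (p + (p + d)) with hb
  have hb1 : 1 < b := Real.one_lt_rpow (by norm_num) (by linarith)
  have hb0 : 0 < b := by linarith
  set C' := C * 8 ^ p * 4 ^ (p + d) with hC'
  have hC'0 : 0 < C' := by positivity
  set q := b ^ (-(1 / β)) with hq
  have hq0 : 0 < q := by positivity
  have hq1 : q < 1 := Real.rpow_lt_one_of_one_lt_of_neg hb1 (by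
    have : 0 < 1 / β := by positivity
    linarith)
  have hqβ : q ^ β = b⁻¹ := by
    rw [hq, ← Real.rpow_mul hb0.le, neg_mul, one_div_mul_cancel hβ0.ne', Real.rpow_neg_one]
  refine ⟨min (1 / 2) ((q / C') ^ (1 / β)), by positivity,
    (min_le_left _ _).trans_lt (by norm_num), ?_⟩
  intro K Ω v x₀ ρ R k h hsmall
  set ν := min (1 / 2) ((q / C') ^ (1 / β))
  have hν0 : 0 < ν := by positivity
  have hCν : C' * ν ^ β ≤ q := by
    have : ν ^ β ≤ q / C' := by
      calc ν ^ β ≤ ((q / C') ^ (1 / β)) ^ β :=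
            Real.rpow_le_rpow hν0.le (min_le_right _ _) hβ0.le
        _ = q / C' := by
            rw [← Real.rpow_mul (by positivity), one_div_mul_cancel hβ0.ne', Real.rpow_one]
    calc C' * ν ^ β ≤ C' * (q / C') := by gcongr
      _ = q := by field_simp
  have hρ := h.pos
  have hk := h.level_pos
  have hV : 0 < volume.real (ball x₀ ρ) := volumeReal_ball_pos x₀ hρ
  -- The levels stop at `3k/4` rather than `k/2`, so that a non-strict bound in the limit still
  -- gives a strict one at `k/2`.
  let l : ℕ → ℝ := fun n => 3 * k / 4 + k / 4 * (1 / 2) ^ n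
  let r : ℕ → ℝ := fun n => ρ / 2 + ρ / 2 * (1 / 2) ^ n
  let Y : ℕ → ℝ := fun n =>
    volume.real (sublevelBall v (l n) x₀ (r n)) / volume.real (ball x₀ ρ)
  have hY0 : ∀ n, 0 ≤ Y n := fun n => by positivity
  have hrec : ∀ n, Y (n + 1) ≤ C' * b ^ n * Y n ^ (1 + β) := by
    intro n
    have hz0 : (0 : ℝ) < (1 / 2) ^ n := by positivity
    have hz1 : (1 / 2 : ℝ) ^ n ≤ 1 := pow_le_one₀ (by norm_num) (by norm_num)
    have hl : l n - l (n + 1) = k / (8 * 2 ^ n) := by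
      simp only [l, pow_succ, one_div, inv_pow]; field_simp; ring
    have hr : r n - r (n + 1) = ρ / (4 * 2 ^ n) := by
      simp only [r, pow_succ, one_div, inv_pow]; field_simp; ring
    have hlpos : 0 < l n - l (n + 1) := by rw [hl]; positivity
    have hrpos : 0 < r n - r (n + 1) := by rw [hr]; positivity
    have := hdec K Ω v x₀ ρ R k h (l (n + 1)) (l n) (r (n + 1)) (r n)
      (by simp only [l]; positivity) (by linarith) (by simp only [l]; nlinarith) (by linarith)
      (by simp only [r]; linarith [(by positivity : 0 < ρ / 2 * (1 / 2) ^ (n + 1))])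
      (by simp only [r]; nlinarith)
    refine this.trans (le_of_eq ?_)
    rw [hl, hr, hdN]
    have e1 : k / (k / (8 * 2 ^ n)) = 8 * 2 ^ n := by field_simp
    have e2 : ρ / (ρ / (4 * 2 ^ n)) = 4 * 2 ^ n := by field_simp
    have e3 : b ^ n = ((2 : ℝ) ^ n) ^ p * ((2 : ℝ) ^ n) ^ (p + d) := by
      rw [← Real.rpow_add (by positivity), hb, ← Real.rpow_natCast 2 n, ← Real.rpow_natCast _ n,
        ← Real.rpow_mul (by norm_num), ← Real.rpow_mul (by norm_num), mul_comm]
    rw [e1, e2, Real.mul_rpow (by norm_num) (by positivity),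
      Real.mul_rpow (by norm_num) (by positivity), e3, hC']
    ring
  have hY00 : Y 0 ≤ ν := by
    have e1 : l 0 = k := by simp only [l, pow_zero]; ring
    have e2 : r 0 = ρ := by simp only [r, pow_zero]; ring
    simp only [Y, e1, e2]
    rwa [div_le_iff₀ hV]
  have hlim : ∀ n, volume.real (sublevelBall v (3 * k / 4) x₀ (ρ / 2)) / volume.real (ball x₀ ρ) ≤
      ν * q ^ n := fun n => by
    refine le_trans ?_ (le_mul_pow_of_superlinear_recursion hC'0.le hb0.le hβ0.le hν0 hq0 hY0 hrec
      (by rw [hqβ, mul_inv_cancel₀ hb0.ne']) hCν hY00 n)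
    refine div_le_div_of_nonneg_right (measureReal_mono (sublevelBall_mono ?_ ?_) ?_) hV.le
    · simp only [l]; linarith [(by positivity : 0 < k / 4 * (1 / 2) ^ n)]
    · simp only [r]; linarith [(by positivity : 0 < ρ / 2 * (1 / 2) ^ n)]
    · exact ((measure_mono sublevelBall_subset).trans_lt measure_ball_lt_top).ne
  have hzero : volume.real (sublevelBall v (3 * k / 4) x₀ (ρ / 2)) / volume.real (ball x₀ ρ) ≤ 0 := by
    have ht := (tendsto_pow_atTop_nhds_zero_of_lt_one hq0.le hq1).const_mul ν
    rw [mul_zero] at ht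
    exact ge_of_tendsto' ht hlim
  have h0 : volume.real (sublevelBall v (3 * k / 4) x₀ (ρ / 2)) = 0 := by
    rw [div_le_iff₀ hV, zero_mul] at hzero
    exact le_antisymm hzero measureReal_nonneg
  exact (measureReal_eq_zero_iff
    ((measure_mono sublevelBall_subset).trans_lt measure_ball_lt_top).ne).1 h0

end DeGiorgiIteration

/-! ### From the function spaces of the statement to the iteration. -/

section Reduction

variable {N : ℕ} {p s d : ℝ} {u v : Rn N → ℝ} {x₀ : Rn N} {R : ℝ}

theorem MemLpLoc.aestronglyMeasurable (h : MemLpLoc p u) : AEStronglyMeasurable u volume := by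
  have hU : ⋃ n : ℕ, closedBall (0 : Rn N) n = univ := by
    refine eq_univ_of_forall fun x => mem_iUnion.2 ?_
    obtain ⟨n, hn⟩ := exists_nat_ge ‖x‖
    exact ⟨n, by simpa using hn⟩
  rw [← Measure.restrict_univ (μ := volume), ← hU, aestronglyMeasurable_iUnion_iff]
  exact fun n => (h _ (isCompact_closedBall 0 n)).1

theorem ae_sub_eq_sub {μ : ℝ} (h : ∀ᵐ x, v x = u x - μ) :
    ∀ᵐ z : Rn N × Rn N, v z.1 - v z.2 = u z.1 - u z.2 := by
  have h1 : ∀ᵐ z : Rn N × Rn N, v z.1 = u z.1 - μ :=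
    (Measure.quasiMeasurePreserving_fst (μ := volume) (ν := volume)).ae h
  have h2 : ∀ᵐ z : Rn N × Rn N, v z.2 = u z.2 - μ :=
    (Measure.quasiMeasurePreserving_snd (μ := volume) (ν := volume)).ae h
  filter_upwards [h1, h2] with z e1 e2
  rw [e1, e2]; ring

theorem weakForm_congr_sub (h : ∀ᵐ z : Rn N × Rn N, v z.1 - v z.2 = u z.1 - u z.2)
    (K : Rn N → Rn N → ℝ) (φ : Rn N → ℝ) : weakForm p K v φ = weakForm p K u φ := by
  refine integral_congr_ae ?_
  filter_upwards [h] with z hz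
  rw [hz]

theorem HasFiniteEnergy.congr_sub (hu : HasFiniteEnergy p d u x₀ R) (hv : Measurable v)
    (h : ∀ᵐ z : Rn N × Rn N, v z.1 - v z.2 = u z.1 - u z.2) : HasFiniteEnergy p d v x₀ R := by
  refine ⟨hv, ?_, fun r hr => ?_⟩
  · refine (lintegral_congr_ae (ae_restrict_of_ae ?_)).trans_lt hu.inner
    filter_upwards [h] with z hz
    rw [hz]
  · refine (lintegral_congr_ae (ae_restrict_of_ae ?_)).trans_lt (hu.outer r hr)
    filter_upwards [h] with z hz
    rw [hz]

theorem lintegral_outer_lt_top (hp : 1 < p) (hd : (N : ℝ) < d) (hu : Measurable u) {r : ℝ}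
    (hr : r < R) (hint : ∫⁻ x in ball x₀ r, ENNReal.ofReal (|u x| ^ (p - 1)) < ∞)
    (htail : ∫⁻ x, ENNReal.ofReal (|u x| ^ (p - 1) / (1 + ‖x‖) ^ d) < ∞) :
    ∫⁻ z in ball x₀ r ×ˢ (ball x₀ R)ᶜ,
      ENNReal.ofReal (|u z.1 - u z.2| ^ (p - 1) / ‖z.1 - z.2‖ ^ d) < ∞ := by
  rcases le_or_gt r 0 with hr0 | hr0
  · rw [ball_eq_empty.2 hr0]; simp
  have hd0 : 0 < d := by
    have : (0 : ℝ) ≤ N := by positivity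
    linarith
  have hR : 0 < R := hr0.trans hr
  -- The quotient `(τ - r) / (1 + ‖x₀‖ + τ)` increases with `τ = ‖y - x₀‖ ≥ R`, and `c` is its value
  -- at `τ = R`.
  set c := (R - r) / (1 + ‖x₀‖ + R) with hc
  have hc0 : 0 < c := div_pos (by linarith) (by positivity)
  have hdist : ∀ x ∈ ball x₀ r, ∀ y ∈ (ball x₀ R)ᶜ, c * (1 + ‖y‖) ≤ ‖x - y‖ := by
    intro x hx y hy
    rw [mem_ball, dist_eq_norm] at hx
    rw [mem_compl_iff, mem_ball, dist_eq_norm, not_lt] at hy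
    have h1 : ‖y - x₀‖ ≤ ‖x - y‖ + ‖x - x₀‖ := by
      have : y - x₀ = -(x - y) + (x - x₀) := by abel
      rw [this]
      exact (norm_add_le _ _).trans (by rw [norm_neg])
    have h2 : ‖y‖ ≤ ‖y - x₀‖ + ‖x₀‖ := by
      simpa using norm_add_le (y - x₀) x₀
    have hx₀ := norm_nonneg x₀
    rw [hc, div_mul_eq_mul_div, div_le_iff₀ (by positivity)]
    nlinarith
  set I := ∫⁻ x in ball x₀ r, ENNReal.ofReal (|u x| ^ (p - 1))
  set J := ∫⁻ y : Rn N, ENNReal.ofReal ((1 + ‖y‖) ^ (-d))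
  set T := ∫⁻ y, ENNReal.ofReal (|u y| ^ (p - 1) / (1 + ‖y‖) ^ d)
  have hJ : J < ∞ := finite_integral_one_add_norm (by simpa using hd)
  rw [Measure.volume_eq_prod, setLIntegral_prod _ (by fun_prop)]
  calc ∫⁻ x in ball x₀ r, ∫⁻ y in (ball x₀ R)ᶜ,
        ENNReal.ofReal (|u x - u y| ^ (p - 1) / ‖x - y‖ ^ d)
      ≤ ∫⁻ x in ball x₀ r, ENNReal.ofReal (2 ^ (p - 1) * (c ^ d)⁻¹) *
          (ENNReal.ofReal (|u x| ^ (p - 1)) * J + T) := by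
        refine setLIntegral_mono (by fun_prop) fun x hx => ?_
        calc ∫⁻ y in (ball x₀ R)ᶜ, ENNReal.ofReal (|u x - u y| ^ (p - 1) / ‖x - y‖ ^ d)
            ≤ ∫⁻ y in (ball x₀ R)ᶜ, ENNReal.ofReal (2 ^ (p - 1) * (c ^ d)⁻¹) *
                (ENNReal.ofReal (|u x| ^ (p - 1)) * ENNReal.ofReal ((1 + ‖y‖) ^ (-d)) +
                  ENNReal.ofReal (|u y| ^ (p - 1) / (1 + ‖y‖) ^ d)) := by
              refine setLIntegral_mono (by fun_prop) fun y hy => ?_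
              rw [← ENNReal.ofReal_mul (by positivity), ← ENNReal.ofReal_add (by positivity)
                (by positivity), ← ENNReal.ofReal_mul (by positivity)]
              refine ENNReal.ofReal_le_ofReal ?_
              have h1 : |u x - u y| ^ (p - 1) ≤
                  2 ^ (p - 1) * (|u x| ^ (p - 1) + |u y| ^ (p - 1)) :=
                (Real.rpow_le_rpow (abs_nonneg _) (abs_sub _ _) (by linarith)).trans
                  (add_rpow_le_two_rpow_mul (by linarith) (abs_nonneg _) (abs_nonneg _))
              have h2 := hdist x hx y hy
              calc |u x - u y| ^ (p - 1) / ‖x - y‖ ^ d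
                  ≤ 2 ^ (p - 1) * (|u x| ^ (p - 1) + |u y| ^ (p - 1)) / (c * (1 + ‖y‖)) ^ d := by
                    gcongr
                _ = _ := by
                    rw [Real.mul_rpow hc0.le (by positivity), Real.rpow_neg (by positivity)]
                    field_simp
          _ ≤ ∫⁻ y, ENNReal.ofReal (2 ^ (p - 1) * (c ^ d)⁻¹) *
                (ENNReal.ofReal (|u x| ^ (p - 1)) * ENNReal.ofReal ((1 + ‖y‖) ^ (-d)) +
                  ENNReal.ofReal (|u y| ^ (p - 1) / (1 + ‖y‖) ^ d)) :=
              setLIntegral_le_lintegral _ _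
          _ = _ := by
              rw [lintegral_const_mul _ (by fun_prop), lintegral_add_left (by fun_prop),
                lintegral_const_mul _ (by fun_prop)]
    _ = ENNReal.ofReal (2 ^ (p - 1) * (c ^ d)⁻¹) * (I * J + T * volume (ball x₀ r)) := by
        rw [lintegral_const_mul _ (by fun_prop), lintegral_add_left (by fun_prop),
          lintegral_mul_const _ (by fun_prop), setLIntegral_const]
    _ < ∞ := ENNReal.mul_lt_top ENNReal.ofReal_lt_top (ENNReal.add_lt_top.2
        ⟨ENNReal.mul_lt_top hint hJ, ENNReal.mul_lt_top htail measure_ball_lt_top⟩)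

theorem MemTildeSobolev.hasFiniteEnergy (hp : 1 < p) (hps : 0 < p * s)
    (hu : MemTildeSobolev p s u (ball x₀ R)) (hm : Measurable u) :
    HasFiniteEnergy p ((N : ℝ) + p * s) u x₀ R := by
  obtain ⟨hloc, ⟨V, -, -, hUV, hLp, hG⟩, htail⟩ := hu
  refine ⟨hm, ?_, fun r hr => ?_⟩
  · have hsub : ball x₀ R ⊆ V := subset_closure.trans hUV
    refine (lintegral_mono_set (prod_mono hsub hsub)).trans_lt ?_
    exact (ENNReal.rpow_lt_top_iff_of_pos (by positivity)).1 hG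
  · refine lintegral_outer_lt_top hp (by linarith) hm hr ?_ htail
    have h1 := hloc _ (isCompact_closedBall x₀ r)
    have h2 := h1.integrable_norm_rpow (by simpa using hp.trans' one_pos) ENNReal.ofReal_ne_top
    rw [ENNReal.toReal_ofReal (by linarith)] at h2
    -- Since `p - 1` may be less than `1`, the bound `|u|^{p-1} ≤ 1 + |u|^p` is used in place of an
    -- embedding of Lebesgue spaces.
    have h3 : Integrable (fun x => 1 + ‖u x‖ ^ p) (volume.restrict (closedBall x₀ r)) :=
      (integrableOn_const (isCompact_closedBall x₀ r).measure_lt_top.ne).add h2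
    refine (lintegral_mono_set ball_subset_closedBall).trans_lt
      (lt_of_le_of_lt (lintegral_mono fun x => ENNReal.ofReal_le_ofReal ?_) h3.lintegral_lt_top)
    rw [Real.norm_eq_abs]
    rcases le_total |u x| 1 with h | h
    · have := Real.rpow_le_one (abs_nonneg (u x)) h (by linarith : 0 ≤ p - 1)
      have : 0 ≤ |u x| ^ p := by positivity
      linarith
    · have := Real.rpow_le_rpow_of_exponent_le h (by linarith : p - 1 ≤ p)
      linarith

theorem MemTildeSobolevLoc.congr_ae {Ω : Set (Rn N)} (hu : MemTildeSobolevLoc p s u Ω)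
    (h : u =ᵐ[volume] v) : MemTildeSobolevLoc p s v Ω := by
  have hloc : MemLpLoc p v := fun A hA => (hu.1 A hA).ae_eq (ae_restrict_of_ae h)
  have hsub : ∀ᵐ z : Rn N × Rn N, u z.1 - u z.2 = v z.1 - v z.2 :=
    ae_sub_eq_sub (μ := 0) (by simp only [sub_zero]; exact h)
  refine ⟨hloc, fun U h1 h2 h3 h4 => ?_⟩
  obtain ⟨-, ⟨V, hV, hc, hUV, hLp, hG⟩, htail⟩ := hu.2 U h1 h2 h3 h4
  refine ⟨hloc, ⟨V, hV, hc, hUV, hLp.ae_eq (ae_restrict_of_ae h), ?_⟩, ?_⟩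
  · refine lt_of_le_of_lt (le_of_eq ?_) hG
    unfold gagliardoSeminorm
    congr 1
    refine lintegral_congr_ae (ae_restrict_of_ae ?_)
    filter_upwards [hsub] with z hz
    rw [hz]
  · refine lt_of_le_of_lt (le_of_eq ?_) htail
    refine lintegral_congr_ae ?_
    filter_upwards [h] with x hx
    rw [hx]

/-- Undoes the power `1 / (p - 1)` in the tail. The factor `γ^{-(p-1)}` becomes the constant `T` of
the iteration, which is how `ν` comes to depend on `γ`. -/
theorem lintegral_le_of_tail_lt (hp : 1 < p) {γ k ρ : ℝ} (hγ : 0 < γ) (hk : 0 < k) (hρ : 0 < ρ)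
    (h : ENNReal.ofReal γ * tail p s u x₀ ρ < ENNReal.ofReal k) :
    ∫⁻ x in (ball x₀ ρ)ᶜ, ENNReal.ofReal (|u x| ^ (p - 1) / ‖x - x₀‖ ^ ((N : ℝ) + p * s)) ≤
      ENNReal.ofReal (γ ^ (-(p - 1)) * k ^ (p - 1) * ρ ^ (-(p * s))) := by
  have hp1 : 0 < p - 1 := by linarith
  unfold tail at h
  set I := ∫⁻ x in (ball x₀ ρ)ᶜ, ENNReal.ofReal (|u x| ^ (p - 1) / ‖x - x₀‖ ^ ((N : ℝ) + p * s))
  have hγE : ENNReal.ofReal γ ≠ 0 := by simpa using hγ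
  have h1 : (ENNReal.ofReal (ρ ^ (p * s)) * I) ^ (1 / (p - 1)) ≤ ENNReal.ofReal (k / γ) := by
    rw [ENNReal.ofReal_div_of_pos hγ, ENNReal.le_div_iff_mul_le (Or.inl hγE)
      (Or.inl ENNReal.ofReal_ne_top), mul_comm]
    exact h.le
  have h2 : ENNReal.ofReal (ρ ^ (p * s)) * I ≤ ENNReal.ofReal ((k / γ) ^ (p - 1)) := by
    have := ENNReal.rpow_le_rpow h1 hp1.le
    rwa [← ENNReal.rpow_mul, one_div_mul_cancel hp1.ne', ENNReal.rpow_one,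
      ENNReal.ofReal_rpow_of_pos (by positivity)] at this
  have hρE : ENNReal.ofReal (ρ ^ (p * s)) ≠ 0 := by
    simpa using Real.rpow_pos_of_pos hρ (p * s)
  calc I ≤ ENNReal.ofReal ((k / γ) ^ (p - 1)) / ENNReal.ofReal (ρ ^ (p * s)) := by
        rwa [ENNReal.le_div_iff_mul_le (Or.inl hρE) (Or.inl ENNReal.ofReal_ne_top), mul_comm]
    _ = _ := by
        rw [← ENNReal.ofReal_div_of_pos (by positivity), Real.div_rpow hk.le hγ.le,
          Real.rpow_neg hγ.le, Real.rpow_neg hρ.le]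
        congr 1
        field_simp

theorem ae_le_of_le_essInfOn {μ : ℝ} {U : Set (Rn N)} (h : (μ : EReal) ≤ essInfOn u U) :
    ∀ᵐ x ∂(volume.restrict U), μ ≤ u x := by
  have h1 : ∀ᵐ x ∂(volume.restrict U), essInfOn u U ≤ (u x : EReal) := ae_essInf_le
  filter_upwards [h1] with x hx
  exact_mod_cast h.trans hx

end Reduction

end Nonlocal

end

/-! ### Proof of the proposition. -/

theorem proposition3p2 (N : ℕ) (hN : 2 ≤ N) (p s : ℝ) (hp : 1 < p) (hs₀ : 0 < s) (hs₁ : s < 1)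
    (hps : p * s < N) (Ω : Set (Nonlocal.Rn N)) (hΩ : IsOpen Ω) (hΩc : IsConnected Ω)
    (Λ₁ Λ₂ : ℝ) (hΛ₁ : 0 < Λ₁) (hΛ₂ : Λ₁ ≤ Λ₂) (γ : ℝ) (hγ₀ : 0 < γ) (hγ₁ : γ < 1) :
    ∃ ν : ℝ, 0 < ν ∧ ν < 1 ∧
      ∀ (K : Nonlocal.Rn N → Nonlocal.Rn N → ℝ) (u : Nonlocal.Rn N → ℝ) (x₀ : Nonlocal.Rn N)
        (ρbar ρ₀ k μ : ℝ),
        Nonlocal.IsKernel p s Λ₁ Λ₂ K →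
        Nonlocal.IsSolution p s K Ω u →
        Metric.closedBall x₀ ρbar ⊆ Ω →
        0 < ρ₀ → ρ₀ < ρbar → 0 < k →
        (μ : EReal) ≤ Nonlocal.essInfOn u (Metric.ball x₀ ρbar) →
        ENNReal.ofReal γ * Nonlocal.tail p s (fun x => (u x - μ)⁻) x₀ ρ₀ < ENNReal.ofReal k →
        volume (Metric.ball x₀ ρ₀ ∩ {x | u x ≤ μ + k}) ≤
          ENNReal.ofReal ν * volume (Metric.ball x₀ ρ₀) →
        ∀ᵐ x ∂(volume.restrict (Metric.ball x₀ (ρ₀ / 2))), μ + k / 2 < u x := by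
  obtain ⟨ν, hν0, hν1, H⟩ := Nonlocal.exists_deGiorgi_smallness (N := N) (by omega) hp hs₀ hs₁ hΛ₁ hΛ₂
    (T := γ ^ (-(p - 1))) (by positivity)
  refine ⟨ν, hν0, hν1, ?_⟩
  intro K u x₀ R ρ k μ hK hu hball hρ hρR hk hinf htail hsmall
  classical
  have hR : 0 < R := hρ.trans hρR
  have hps0 : 0 < p * s := by positivity
  have hballΩ : Metric.ball x₀ R ⊆ Ω := Metric.ball_subset_closedBall.trans hball
  have hum : AEStronglyMeasurable u volume := hu.1.1.1.aestronglyMeasurable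
  set u₀ := hum.mk u
  have hu₀ : Measurable u₀ := hum.stronglyMeasurable_mk.measurable
  have huu₀ : u =ᵐ[volume] u₀ := hum.ae_eq_mk
  have hE₀ : Nonlocal.HasFiniteEnergy p ((N : ℝ) + p * s) u₀ x₀ R :=
    ((hu.1.1.congr_ae huu₀).2 _ Metric.isOpen_ball
      ((convex_ball x₀ R).isConnected (Metric.nonempty_ball.2 hR)) Metric.isBounded_ball
      hballΩ).hasFiniteEnergy hp hps0 hu₀
  -- A representative of `u - μ` that is Borel measurable and nonnegative at every point of the
  -- ball, as the pointwise estimates require. The weak form, the energies, the tail and the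
  -- measures do not see the change on a null set.
  set v : Nonlocal.Rn N → ℝ := fun x => if x ∈ Metric.ball x₀ R then max (u₀ x - μ) 0 else u₀ x - μ
  have hv : Measurable v := Measurable.ite Metric.isOpen_ball.measurableSet
    ((hu₀.sub_const μ).max measurable_const) (hu₀.sub_const μ)
  have hvu : ∀ᵐ x, v x = u x - μ := by
    filter_upwards [huu₀, (ae_restrict_iff' Metric.isOpen_ball.measurableSet).1
      (Nonlocal.ae_le_of_le_essInfOn hinf)] with x h1 h2
    by_cases hx : x ∈ Metric.ball x₀ R
    · simp only [v, if_pos hx, ← h1]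
      exact max_eq_left (by linarith [h2 hx])
    · simp only [v, if_neg hx, ← h1]
  have hvu₀ : ∀ᵐ x, v x = u₀ x - μ := by
    filter_upwards [hvu, huu₀] with x h1 h2
    rw [h1, h2]
  have hset : Nonlocal.DeGiorgiSetting p s Λ₁ Λ₂ (γ ^ (-(p - 1))) K Ω v x₀ ρ R k :=
    { kernel := hK
      energy := hE₀.congr_sub hv (Nonlocal.ae_sub_eq_sub hvu₀)
      nonneg := fun x hx => by
        simp only [v, if_pos hx]
        exact le_max_right _ _
      subset := hballΩ
      weak := fun ψ hψ => by
        rw [Nonlocal.weakForm_congr_sub (Nonlocal.ae_sub_eq_sub hvu)]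
        exact hu.1.2 ψ hψ
      pos := hρ
      lt := hρR
      level_pos := hk
      tail_le := by
        refine le_trans (le_of_eq ?_) (Nonlocal.lintegral_le_of_tail_lt hp hγ₀ hk hρ htail)
        refine lintegral_congr_ae (ae_restrict_of_ae ?_)
        filter_upwards [hvu] with x hx
        rw [hx, abs_of_nonneg (negPart_nonneg (u x - μ))] }
  have hle : volume (Nonlocal.sublevelBall v k x₀ ρ) ≤ ENNReal.ofReal ν * volume (Metric.ball x₀ ρ) := by
    refine (measure_mono_ae ?_).trans hsmall
    filter_upwards [hvu] with x hx hxA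
    refine ⟨hxA.1, ?_⟩
    have := hxA.2
    rw [hx] at this
    show u x ≤ μ + k
    linarith
  have hreal : volume.real (Nonlocal.sublevelBall v k x₀ ρ) ≤ ν * volume.real (Metric.ball x₀ ρ) := by
    have h1 := ENNReal.toReal_mono
      (ENNReal.mul_ne_top ENNReal.ofReal_ne_top measure_ball_lt_top.ne) hle
    rwa [ENNReal.toReal_mul, ENNReal.toReal_ofReal hν0.le] at h1
  have hzero := H K Ω v x₀ ρ R k hset hreal
  rw [ae_restrict_iff' Metric.isOpen_ball.measurableSet]
  filter_upwards [hvu, measure_eq_zero_iff_ae_notMem.1 hzero] with x h1 h2 hx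
  have h3 : 3 * k / 4 ≤ v x := not_lt.1 fun h => h2 ⟨hx, h⟩
  rw [h1] at h3
  linarith
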